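/- A unimodular lattice in dimension $n$ is a full-rank lattice $\Lambda\subset\mathbb R^n$ of determinant $\pm1$ such that $(x,y)\in\mathbb Z$ for all $x,y\in\Lambda$. Its theta function is $\Theta_\Lambda(z)=\sum_{x\in\Lambda}e^{\pi i\|x\|^2z}$ for $\operatorname{Im} z>0$, and its secrecy function is $\Xi_\Lambda(y)=\Theta_{\mathbb Z^n}(yi)/\Theta_\Lambda(yi)$ for real $y>0$. The Belfiore–Solé conjecture asserts that, for every $n$ and every unimodular lattice $\Lambda$ in dimension $n$, the function $\Xi_\Lambda$ attains its maximum over $y>0$ at $y=1$. A vector $w\in\Lambda$ is characteristic if $(w,v)\equiv(v,v)\pmod 2$ for all $v\in\Lambda$. An $n-8k$ lattice is a unimodular lattice in dimension $n$ all of whose characteristic vectors $w$ satisfy $(w,w)\ge n-8k$. The norm of a vector $x$ is $(x,x)=\|x\|^2$. Theorem. Assume the Belfiore–Solé conjecture. Then for every integer $n\ge 14941$ there is no $n-32$ lattice in dimension $n$ without nonzero vectors of norm at most $3$. -/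

import Mathlib

namespace SecrecyGain

/-- A subgroup `Λ` of Euclidean space `ℝⁿ` is a (positive definite) unimodular lattice if it is
a full-rank lattice, all inner products of its vectors are integers, and its determinant is one
(the covolume is the absolute value of the determinant of a generator matrix). -/
structure IsUnimodular {n : ℕ} (Λ : Submodule ℤ (EuclideanSpace ℝ (Fin n))) : Prop where
  discrete : DiscreteTopology Λ
  span_top : Submodule.span ℝ (Λ : Set (EuclideanSpace ℝ (Fin n))) = ⊤
  inner_int : ∀ x ∈ Λ, ∀ y ∈ Λ, ∃ m : ℤ, inner ℝ x y = (m : ℝ)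
  covolume_eq_one : ZLattice.covolume Λ = 1

/-- The lattice `ℤⁿ` in `ℝⁿ`. -/
noncomputable def cubicLattice (n : ℕ) : Submodule ℤ (EuclideanSpace ℝ (Fin n)) :=
  Submodule.span ℤ (Set.range (EuclideanSpace.basisFun (Fin n) ℝ).toBasis)

/-- The theta function `Θ_Λ(z) = ∑_{x ∈ Λ} exp(π i ‖x‖² z)`, for `z` in the upper half plane. -/
noncomputable def theta {n : ℕ} (Λ : Submodule ℤ (EuclideanSpace ℝ (Fin n))) (z : ℂ) : ℂ :=
  ∑' x : Λ, Complex.exp (Real.pi * Complex.I * ((‖(x : EuclideanSpace ℝ (Fin n))‖ ^ 2 : ℝ) : ℂ) * z)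

/-- On the imaginary axis the theta function is a series of positive real numbers. -/
theorem theta_mul_I {n : ℕ} (Λ : Submodule ℤ (EuclideanSpace ℝ (Fin n))) (y : ℝ) :
    theta Λ (y * Complex.I) =
      ((∑' x : Λ, Real.exp (-Real.pi * ‖(x : EuclideanSpace ℝ (Fin n))‖ ^ 2 * y) : ℝ) : ℂ) := by
  rw [theta, Complex.ofReal_tsum]
  refine tsum_congr fun x => ?_
  rw [Complex.ofReal_exp]
  congr 1
  push_cast
  linear_combination ((Real.pi : ℂ) * (‖(x : EuclideanSpace ℝ (Fin n))‖ : ℂ) ^ 2 * y) * Complex.I_sq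

/-- The secrecy function `Ξ_Λ(y) = Θ_{ℤⁿ}(yi) / Θ_Λ(yi)`, for `y > 0`; both theta values are real
by `theta_mul_I`. -/
noncomputable def secrecyFunction {n : ℕ} (Λ : Submodule ℤ (EuclideanSpace ℝ (Fin n))) (y : ℝ) :
    ℝ :=
  (theta (cubicLattice n) (y * Complex.I) / theta Λ (y * Complex.I)).re

/-- The conjecture of Belfiore and Solé: the secrecy function of every unimodular lattice attains
its maximum over `y > 0` at `y = 1`. -/
def BelfioreSoleConjecture : Prop :=
  ∀ (n : ℕ) (Λ : Submodule ℤ (EuclideanSpace ℝ (Fin n))), IsUnimodular Λ →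
    IsMaxOn (secrecyFunction Λ) (Set.Ioi 0) 1

/-- `w ∈ Λ` is a characteristic vector if `(w, v) ≡ (v, v) (mod 2)` for all `v ∈ Λ`. -/
def IsCharacteristic {n : ℕ} (Λ : Submodule ℤ (EuclideanSpace ℝ (Fin n)))
    (w : EuclideanSpace ℝ (Fin n)) : Prop :=
  w ∈ Λ ∧ ∀ v ∈ Λ, ∃ m : ℤ, inner ℝ w v - inner ℝ v v = 2 * (m : ℝ)

/-- A unimodular lattice in dimension `n` is an `n - 8k` lattice if all of its characteristic
vectors have norm `(w, w)` at least `n - 8k`. -/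
def IsNSubLattice {n : ℕ} (k : ℕ) (Λ : Submodule ℤ (EuclideanSpace ℝ (Fin n))) : Prop :=
  IsUnimodular Λ ∧ ∀ w, IsCharacteristic Λ w → (n : ℝ) - 8 * (k : ℝ) ≤ inner ℝ w w

end SecrecyGain

/-! The secrecy function of a unimodular lattice tends to 1 as y → ∞, since both theta series tend
to 1. If y = 1 is a maximum, the value there is at least 1. The contradiction comes from Θ_Λ(i) >
θ₃(i)^n, where θ₃ is `jacobiTheta`.

Write q = exp(πiz), θ₂ = q^(1/4) `psi` and Δ₈ = θ₂⁴θ₄⁴/16 = q + O(q²). Poisson summation and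
self-duality make Θ_Λ a form of weight n/2 for the theta group, whose cusps are i∞ and 1. At the
cusp 1 its expansion runs over the shifted lattice w/2 + Λ with w characteristic, so the n - 32
condition makes it O(q^((n-32)/4)). The forms θ₃^(n-8j) Δ₈^j with j ≤ 4 have the same decay there. A
norm down to SL₂(ℤ), divided by a power of the discriminant, shows that such a form vanishes if it
is O(q⁵) at i∞ (`eq_zero_of_theta_group`). Hence Θ_Λ is the combination of these five forms with
expansion 1 + A q⁴ + O(q⁵), where A ≥ 0 counts vectors of norm 4 (`theta_eq_heckePoly`,
`qExp_heckePoly`).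

At z = i the ratio x = Δ₈/θ₃⁸ is a positive constant, and Θ_Λ(i)/θ₃(i)^n is a quartic in x whose
coefficient of x^j grows like (-2n)^j/j!. The x⁴ and x² terms beat the x³ and x terms for large n
(`heckePoly_gt`). -/

namespace SecrecyGain

/-! ### Poisson summation for self-dual lattices, via Fourier series on the torus -/

section Poisson

open MeasureTheory Complex FourierTransform
variable {n : ℕ} {Λ : Submodule ℤ (EuclideanSpace ℝ (Fin n))} [DiscreteTopology Λ] [IsZLattice ℝ Λ]

/-- The coordinates with respect to a `ℤ`-basis of a lattice of covolume one preserve volume. -/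
theorem measurePreserving_equivFun_symm (b : Module.Basis (Fin n) ℤ Λ)
    (hcov : ZLattice.covolume Λ = 1) :
    MeasurePreserving ((b.ofZLatticeBasis ℝ Λ).equivFun.symm.toContinuousLinearEquiv)
      volume volume := by
  set B := b.ofZLatticeBasis ℝ Λ
  have h1 : B.addHaar = volume := by
    rw [B.addHaar_eq_iff, Module.Basis.coe_parallelepiped,
      ← measure_congr (ZSpan.fundamentalDomain_ae_parallelepiped B volume)]
    have := ZLattice.covolume_eq_measure_fundamentalDomain Λ volume
      (ZLattice.isAddFundamentalDomain b volume)
    rw [hcov, measureReal_def] at this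
    rw [← ENNReal.toReal_eq_one_iff]
    exact this.symm
  have h2 : (Pi.basisFun ℝ (Fin n)).addHaar = volume := by
    rw [Module.Basis.addHaar_eq_iff, Module.Basis.coe_parallelepiped,
      ← measure_congr (ZSpan.fundamentalDomain_ae_parallelepiped _ volume),
      ZSpan.fundamentalDomain_pi_basisFun, Real.volume_pi_Ico]
    simp
  refine ⟨by fun_prop, ?_⟩
  rw [← h1, ← h2, Module.Basis.map_addHaar]
  congr 1
  ext i
  simp

/-- The torus function obtained from a function that is periodic under a lattice. -/
theorem exists_torus_lift (b : Module.Basis (Fin n) ℤ Λ) (F : EuclideanSpace ℝ (Fin n) → ℂ)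
    (hF : Continuous F) (hper : ∀ x, ∀ l : Λ, F (x + l) = F x) :
    ∃ G : C(UnitAddTorus (Fin n), ℂ), ∀ t : Fin n → ℝ,
      G (fun i => (t i : UnitAddCircle)) = F ((b.ofZLatticeBasis ℝ Λ).equivFun.symm t) := by
  set B := b.ofZLatticeBasis ℝ Λ
  let g : UnitAddTorus (Fin n) → ℂ :=
    fun p => F (B.equivFun.symm fun i => (AddCircle.equivIco 1 0 (p i) : ℝ))
  have hg : ∀ t : Fin n → ℝ, g (fun i => (t i : UnitAddCircle)) = F (B.equivFun.symm t) := by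
    intro t
    have hk : ∀ i, ∃ k : ℤ, ((AddCircle.equivIco 1 0 (t i : UnitAddCircle) : ℝ)) = t i + k := by
      intro i
      refine ⟨-⌊t i⌋, ?_⟩
      rw [AddCircle.coe_equivIco_mk_apply, Int.fract]
      push_cast
      ring_nf
    choose k hk using hk
    have : (fun i => (AddCircle.equivIco 1 0 (t i : UnitAddCircle) : ℝ)) =
      t + fun i => (k i : ℝ) := funext hk
    simp only [g]
    rw [this, map_add, show B.equivFun.symm (fun i => (k i : ℝ)) =
      ((∑ i, k i • b i : Λ) : EuclideanSpace ℝ (Fin n)) from ?_, hper]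
    simp [Module.Basis.equivFun_symm_apply, B, ← Int.cast_smul_eq_zsmul ℝ]
  refine ⟨⟨g, ?_⟩, hg⟩
  -- Continuity descends to the torus along the open quotient map from ℝⁿ, although the chosen
  -- representatives in [0, 1) jump.
  have hq : IsOpenQuotientMap (Pi.map fun (_ : Fin n) (x : ℝ) => (x : UnitAddCircle)) :=
    IsOpenQuotientMap.piMap fun _ => QuotientAddGroup.isOpenQuotientMap_mk
  rw [← hq.continuous_comp_iff]
  have : g ∘ (Pi.map fun (_ : Fin n) (x : ℝ) => (x : UnitAddCircle)) =
    fun t => F (B.equivFun.symm.toContinuousLinearEquiv t) := funext hg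
  rw [this]
  fun_prop

-- The periodization of `f` lives on the torus, and unfolding its Fourier integral gives `𝓕 f`.
-- Frequencies are dual vectors; the bijection `e` expresses self-duality and so lets `Λ` index
-- them.
open scoped RealInnerProductSpace in
theorem hasSum_fourier_lattice (b : Module.Basis (Fin n) ℤ Λ) (hcov : ZLattice.covolume Λ = 1)
    (e : Λ ≃ (Fin n → ℤ)) (he : ∀ (x : Λ) i, ⟪(x : EuclideanSpace ℝ (Fin n)), (b i : EuclideanSpace ℝ (Fin n))⟫ = e x i)
    (f : EuclideanSpace ℝ (Fin n) → ℂ) (hf : Continuous f) (hfi : Integrable f)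
    (hsum : ∀ R : ℝ, ∃ u : Λ → ℝ, Summable u ∧ ∀ x, ‖x‖ ≤ R → ∀ l : Λ, ‖f (x + l)‖ ≤ u l)
    (hhat : Summable fun x : Λ => 𝓕 f (x : EuclideanSpace ℝ (Fin n)))
    (v : EuclideanSpace ℝ (Fin n)) :
    HasSum (fun x : Λ => 𝓕 f (x : EuclideanSpace ℝ (Fin n)) * cexp (2 * Real.pi * I * ⟪(x : EuclideanSpace ℝ (Fin n)), v⟫))
      (∑' l : Λ, f (v + l)) := by
  set B := b.ofZLatticeBasis ℝ Λ
  set F : EuclideanSpace ℝ (Fin n) → ℂ := fun x => ∑' l : Λ, f (x + l)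
  have hFc : Continuous F := by
    rw [continuous_iff_continuousAt]
    intro x
    obtain ⟨u, hu, hb⟩ := hsum (‖x‖ + 1)
    have : ContinuousOn F (Metric.ball 0 (‖x‖ + 1)) := by
      refine continuousOn_tsum (fun l => by fun_prop) hu fun l y hy => hb y ?_ l
      simpa using (Metric.mem_ball.1 hy).le
    exact this.continuousAt (Metric.isOpen_ball.mem_nhds (by simp))
  have hper : ∀ x, ∀ l : Λ, F (x + l) = F x := by
    intro x l
    simp only [F]
    rw [← (Equiv.addLeft l).tsum_eq (fun m : Λ => f (x + m))]
    simp [add_assoc]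
  obtain ⟨G, hG⟩ := exists_torus_lift b F hFc hper
  have hmF : ∀ (x : Λ) (t : Fin n → ℝ), UnitAddTorus.mFourier (e x) (fun i => (t i : UnitAddCircle)) =
      cexp (2 * Real.pi * I * ⟪(x : EuclideanSpace ℝ (Fin n)), B.equivFun.symm t⟫) := by
    intro x t
    simp only [UnitAddTorus.mFourier, ContinuousMap.coe_mk, fourier_coe_apply]
    rw [← Complex.exp_sum, Module.Basis.equivFun_symm_apply, inner_sum]
    simp only [inner_smul_right, B, b.ofZLatticeBasis_apply ℝ Λ, he]
    congr 1
    push_cast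
    rw [Finset.mul_sum]
    refine Finset.sum_congr rfl fun i _ => ?_
    field_simp
  have hcoef : ∀ x : Λ, UnitAddTorus.mFourierCoeff G (e x) = 𝓕 f (x : EuclideanSpace ℝ (Fin n)) := by
    intro x
    rw [UnitAddTorus.mFourierCoeff_eq_integral _ _ 0, Real.fourier_eq']
    let φ : EuclideanSpace ℝ (Fin n) → ℂ := fun y => cexp (((-2 * Real.pi * ⟪y, (x : EuclideanSpace ℝ (Fin n))⟫ : ℝ) : ℂ) * I)
    have hφc : Continuous φ := by fun_prop
    have hφn : ∀ y, ‖φ y‖ = 1 := fun y => Complex.norm_exp_ofReal_mul_I _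
    have hφp : ∀ (l : Λ) y, φ (y + l) = φ y := by
      intro l y
      obtain ⟨k, hk⟩ : ∃ k : ℤ, ⟪(l : EuclideanSpace ℝ (Fin n)), (x : EuclideanSpace ℝ (Fin n))⟫ = k := by
        refine ⟨∑ i, b.repr l i * e x i, ?_⟩
        have : (l : EuclideanSpace ℝ (Fin n)) = ∑ i, (b.repr l i : ℝ) • (b i : EuclideanSpace ℝ (Fin n)) := by
          refine (congrArg Subtype.val (b.sum_repr l).symm).trans ?_
          rw [Submodule.coe_sum]
          refine Finset.sum_congr rfl fun i _ => ?_
          rw [Submodule.coe_smul, Int.cast_smul_eq_zsmul]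
        rw [this, sum_inner]
        push_cast
        refine Finset.sum_congr rfl fun i _ => ?_
        rw [real_inner_smul_left, real_inner_comm, he]
      simp only [φ, inner_add_left, hk]
      rw [← Complex.exp_periodic.int_mul (-k) (((-2 * Real.pi * ⟪y, (x : EuclideanSpace ℝ (Fin n))⟫ : ℝ) : ℂ) * I)]
      congr 1
      push_cast
      ring
    have hD := ZLattice.isAddFundamentalDomain b (volume : Measure (EuclideanSpace ℝ (Fin n)))
    have hDm : MeasurableSet (ZSpan.fundamentalDomain B) := ZSpan.fundamentalDomain_measurableSet B
    -- The Fourier coefficient integrates over a half-open box closed on the other side from the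
    -- fundamental domain; the two differ by a null set.
    have hbox : {t : Fin n → ℝ | ∀ i, t i ∈ Set.Ioc ((0 : Fin n → ℝ) i) ((0 : Fin n → ℝ) i + 1)} =ᵐ[volume]
        (B.equivFun.symm.toContinuousLinearEquiv) ⁻¹' ZSpan.fundamentalDomain B := by
      have h1 : (B.equivFun.symm.toContinuousLinearEquiv) ⁻¹' ZSpan.fundamentalDomain B =
          Set.univ.pi fun i : Fin n => Set.Ico ((0 : Fin n → ℝ) i) ((1 : Fin n → ℝ) i) := by
        ext t
        change B.equivFun.symm t ∈ ZSpan.fundamentalDomain B ↔ _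
        simp only [ZSpan.mem_fundamentalDomain, ← Module.Basis.equivFun_apply,
          LinearEquiv.apply_symm_apply]
        simp
      have h2 : {t : Fin n → ℝ | ∀ i, t i ∈ Set.Ioc ((0 : Fin n → ℝ) i) ((0 : Fin n → ℝ) i + 1)} =
          Set.univ.pi fun i : Fin n => Set.Ioc ((0 : Fin n → ℝ) i) ((1 : Fin n → ℝ) i) := by
        ext t
        simp
      rw [h1, h2]
      exact Measure.univ_pi_Ioc_ae_eq_Icc.trans Measure.univ_pi_Ico_ae_eq_Icc.symm
    have hint : ∀ t : Fin n → ℝ, UnitAddTorus.mFourier (-e x) (fun i => (t i : UnitAddCircle)) •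
        G (fun i => (t i : UnitAddCircle)) =
        (fun y => φ y * F y) (B.equivFun.symm.toContinuousLinearEquiv t) := by
      intro t
      rw [UnitAddTorus.mFourier_neg, hmF, hG, ← Complex.exp_conj, smul_eq_mul]
      congr 2
      have h2 : (starRingEnd ℂ) 2 = 2 := map_ofNat _ 2
      change _ = ((-2 * Real.pi * ⟪B.equivFun.symm t, (x : EuclideanSpace ℝ (Fin n))⟫ : ℝ) : ℂ) * I
      rw [real_inner_comm (B.equivFun.symm t)]
      simp only [map_mul, Complex.conj_ofReal, Complex.conj_I, h2]
      push_cast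
      ring
    simp_rw [hint]
    have hmp : MeasurePreserving (B.equivFun.symm.toContinuousLinearEquiv) volume volume :=
      measurePreserving_equivFun_symm b hcov
    rw [setIntegral_congr_set hbox]
    refine (hmp.setIntegral_preimage_emb
      (B.equivFun.symm.toContinuousLinearEquiv.toHomeomorph).measurableEmbedding
      (fun y => φ y * F y) _).trans ?_
    simp only [smul_eq_mul]
    have hi : Integrable fun y => φ y * f y := by
      refine hfi.bdd_mul (c := 1) hφc.aestronglyMeasurable (.of_forall fun y => (hφn y).le)
    have : VAddInvariantMeasure Λ (EuclideanSpace ℝ (Fin n)) volume :=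
      inferInstanceAs (VAddInvariantMeasure Λ.toAddSubgroup (EuclideanSpace ℝ (Fin n)) volume)
    have : MeasurableConstVAdd Λ (EuclideanSpace ℝ (Fin n)) :=
      inferInstanceAs (MeasurableConstVAdd Λ.toAddSubgroup (EuclideanSpace ℝ (Fin n)))
    rw [hD.integral_eq_tsum'' _ hi]
    obtain ⟨R, hR⟩ := (ZSpan.fundamentalDomain_isBounded B).exists_norm_le
    obtain ⟨u, hu, hb⟩ := hsum R
    have hfin : volume (ZSpan.fundamentalDomain B) < ⊤ :=
      (ZSpan.fundamentalDomain_isBounded B).measure_lt_top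
    rw [integral_tsum_of_summable_integral_norm]
    · refine setIntegral_congr_fun hDm fun y _ => ?_
      simp only [F, ← tsum_mul_left]
      refine tsum_congr fun l => ?_
      have : l +ᵥ y = y + l := add_comm _ _
      rw [this, hφp]
    · intro l
      have : (fun y => φ (l +ᵥ y) * f (l +ᵥ y)) = fun y => (fun y => φ y * f y) ((l : EuclideanSpace ℝ (Fin n)) + y) := rfl
      rw [this]
      exact (hi.comp_add_left _).integrableOn
    · refine Summable.of_nonneg_of_le (fun l => by positivity) (fun l => ?_) (hu.mul_right (volume.real (ZSpan.fundamentalDomain B)))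
      refine (Real.le_norm_self _).trans (norm_setIntegral_le_of_norm_le_const hfin fun y hy => ?_)
      have : l +ᵥ y = y + l := add_comm _ _
      rw [this, norm_norm, norm_mul, hφn, one_mul]
      exact hb y (hR y hy) l
  have hs := UnitAddTorus.hasSum_mFourier_series_apply_of_summable (f := G)
    (by rw [← e.summable_iff]; convert hhat using 1; exact funext hcoef)
    (fun i => (B.equivFun v i : UnitAddCircle))
  rw [← e.hasSum_iff, hG] at hs
  convert hs using 2 with x
  · simp [hcoef, hmF]
  · change _ = fun l : Λ => f (B.equivFun.symm (B.equivFun v) + l)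
    rw [LinearEquiv.symm_apply_apply]

end Poisson

/-! ### Self-duality and characteristic vectors -/

section Unimodular

open MeasureTheory Complex FourierTransform
open scoped RealInnerProductSpace
variable {n : ℕ} {Λ : Submodule ℤ (EuclideanSpace ℝ (Fin n))}

theorem IsUnimodular.isZLattice (h : IsUnimodular Λ) :
    haveI := h.discrete
    IsZLattice ℝ Λ :=
  haveI := h.discrete
  ⟨h.span_top⟩

theorem IsUnimodular.exists_basis (h : IsUnimodular Λ) : Nonempty (Module.Basis (Fin n) ℤ Λ) := by
  have := h.discrete
  have := h.isZLattice
  have := ZLattice.module_free ℝ Λ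
  have := ZLattice.module_finite ℝ Λ
  have hr : Module.finrank ℤ Λ = n := by rw [ZLattice.rank ℝ Λ]; simp
  exact ⟨(Module.finBasis ℤ Λ).reindex (finCongr hr)⟩

/-- A unimodular lattice is its own dual. -/
theorem IsUnimodular.exists_dual_equiv (h : IsUnimodular Λ) (b : Module.Basis (Fin n) ℤ Λ) :
    ∃ e : Λ ≃ (Fin n → ℤ), ∀ (x : Λ) i,
      ⟪(x : EuclideanSpace ℝ (Fin n)), (b i : EuclideanSpace ℝ (Fin n))⟫ = e x i := by
  have := h.discrete
  have := h.isZLattice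
  choose A hA using fun i j => h.inner_int (b i) (b i).2 (b j) (b j).2
  let M : Matrix (Fin n) (Fin n) ℤ := Matrix.of A
  -- The Gram matrix is NᵀN with |det N| equal to the covolume, so it is invertible over ℤ.
  have hdet : M.det = 1 := by
    set o := EuclideanSpace.basisFun (Fin n) ℝ
    have h1 := ZLattice.covolume_eq_det_mul_measureReal Λ volume b o.toBasis
    rw [h.covolume_eq_one, measureReal_congr (ZSpan.fundamentalDomain_ae_parallelepiped _ _)] at h1
    have h2 : volume.real (parallelepiped o.toBasis) = 1 := by
      rw [measureReal_def, OrthonormalBasis.coe_toBasis, o.volume_parallelepiped, ENNReal.toReal_one]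
    rw [h2, mul_one, Module.Basis.det_apply] at h1
    set N := o.toBasis.toMatrix (Subtype.val ∘ b)
    have h3 : M.map (Int.cast : ℤ → ℝ) = N.transpose * N := by
      ext i j
      simp only [M, Matrix.map_apply, Matrix.of_apply, ← hA, Matrix.mul_apply, Matrix.transpose_apply]
      rw [← o.sum_inner_mul_inner]
      refine Finset.sum_congr rfl fun k _ => ?_
      simp [N, Module.Basis.toMatrix_apply, o, EuclideanSpace.inner_single_left,
        EuclideanSpace.inner_single_right]
    have h4 : ((M.det : ℤ) : ℝ) = 1 := by
      have := congrArg Matrix.det h3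
      rw [Matrix.det_mul, Matrix.det_transpose, ← abs_mul_abs_self, ← h1, mul_one] at this
      rw [← this]
      exact (Int.castRingHom ℝ).map_det M
    exact_mod_cast h4
  have hu : IsUnit M := (Matrix.isUnit_iff_isUnit_det M).2 (by simp [hdet])
  have hbij : Function.Bijective (fun c : Fin n → ℤ => Matrix.vecMul c M) :=
    ⟨Matrix.vecMul_injective_of_isUnit hu, Matrix.vecMul_surjective_iff_isUnit.2 hu⟩
  refine ⟨b.equivFun.toEquiv.trans (Equiv.ofBijective _ hbij), fun x i => ?_⟩
  have hx : (x : EuclideanSpace ℝ (Fin n)) =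
      ∑ j, (b.repr x j : ℝ) • (b j : EuclideanSpace ℝ (Fin n)) := by
    refine (congrArg Subtype.val (b.sum_repr x).symm).trans ?_
    rw [Submodule.coe_sum]
    refine Finset.sum_congr rfl fun i _ => ?_
    rw [Submodule.coe_smul, Int.cast_smul_eq_zsmul]
  rw [hx, sum_inner]
  simp [Matrix.vecMul, dotProduct, M, real_inner_smul_left, hA]

/-- Unimodular lattices have characteristic vectors. -/
theorem IsUnimodular.exists_isCharacteristic (h : IsUnimodular Λ) : ∃ w, IsCharacteristic Λ w := by
  obtain ⟨b⟩ := h.exists_basis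
  obtain ⟨e, he⟩ := h.exists_dual_equiv b
  choose c hc using fun i => h.inner_int (b i) (b i).2 (b i) (b i).2
  -- Self-duality gives a vector pairing with each `b i` to (b i, b i). This suffices because v ↦
  -- (v, v) is additive modulo 2.
  refine ⟨e.symm c, (e.symm c).2, fun v hv => ?_⟩
  have hmem : (⟨v, hv⟩ : Λ) ∈ Submodule.span ℤ (Set.range b) := by rw [b.span_eq]; trivial
  suffices ∀ u : Λ, u ∈ Submodule.span ℤ (Set.range b) → ∃ m : ℤ,
    ⟪(e.symm c : EuclideanSpace ℝ (Fin n)), (u : EuclideanSpace ℝ (Fin n))⟫ -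
      ⟪(u : EuclideanSpace ℝ (Fin n)), (u : EuclideanSpace ℝ (Fin n))⟫ = 2 * (m : ℝ) from this _ hmem
  intro u hu
  induction hu using Submodule.span_induction with
  | mem x hx =>
    obtain ⟨i, rfl⟩ := hx
    exact ⟨0, by rw [he, hc]; simp⟩
  | zero => exact ⟨0, by simp⟩
  | add x y _ _ hx hy =>
    obtain ⟨k, hk⟩ := hx
    obtain ⟨l, hl⟩ := hy
    obtain ⟨m, hm⟩ := h.inner_int x x.2 y y.2
    refine ⟨k + l - m, ?_⟩
    push_cast
    rw [inner_add_right, inner_add_add_self, real_inner_comm]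
    rw [real_inner_comm] at hm
    simp only [real_inner_comm] at *
    linarith
  | smul a x _ hx =>
    obtain ⟨k, hk⟩ := hx
    obtain ⟨m, hm⟩ := h.inner_int x x.2 x x.2
    obtain ⟨t, ht⟩ : Even (a * (a - 1)) := Int.even_mul_pred_self a
    refine ⟨a * k - t * m, ?_⟩
    have ht' : (a : ℝ) * (a - 1) = t + t := by exact_mod_cast ht
    rw [Submodule.coe_smul, ← Int.cast_smul_eq_zsmul ℝ, real_inner_smul_right, real_inner_smul_left,
      real_inner_smul_right, hm]
    rw [hm] at hk
    push_cast
    linear_combination (a : ℝ) * hk - (m : ℝ) * ht'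

end Unimodular

/-! ### Transformation of lattice theta series -/

section Gaussian

open MeasureTheory Complex FourierTransform
open scoped RealInnerProductSpace
variable {n : ℕ} {Λ : Submodule ℤ (EuclideanSpace ℝ (Fin n))}

theorem norm_add_sq_ge {E : Type*} [NormedAddCommGroup E] (v x : E) :
    ‖x‖ ^ 2 / 2 - ‖v‖ ^ 2 ≤ ‖v + x‖ ^ 2 := by
  have h : ‖x‖ ≤ ‖v + x‖ + ‖v‖ := by
    have := norm_sub_le (v + x) v
    simpa using this
  nlinarith [sq_nonneg (‖v + x‖ - ‖v‖), norm_nonneg x, norm_nonneg (v + x), norm_nonneg v]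

theorem summable_gaussian [DiscreteTopology Λ] {c : ℝ} (hc : 0 < c) :
    Summable fun x : Λ => Real.exp (-c * ‖(x : EuclideanSpace ℝ (Fin n))‖ ^ 2) := by
  -- This makes ‖x‖^(-2m) summable over the lattice, and the Gaussian is dominated by it.
  set m := Module.finrank ℤ Λ + 1
  have h1 := ZLattice.summable_norm_pow_inv Λ (2 * m) (by omega)
  refine Summable.of_norm_bounded_eventually (h1.mul_left (m.factorial / c ^ m)) ?_
  refine (Set.finite_singleton (0 : Λ)).subset fun x hx => ?_
  by_contra hx0
  refine hx ?_
  have hpos : 0 < ‖x‖ := norm_pos_iff.2 hx0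
  have h2 := Real.pow_div_factorial_le_exp (c * ‖x‖ ^ 2) (by positivity) m
  change ‖Real.exp (-c * ‖(x : EuclideanSpace ℝ (Fin n))‖ ^ 2)‖ ≤ _
  rw [Real.norm_of_nonneg (Real.exp_pos _).le, neg_mul, Real.exp_neg,
    ← AddSubgroupClass.coe_norm, inv_le_comm₀ (Real.exp_pos _) (by positivity)]
  have h3 : ((m.factorial : ℝ) / c ^ m * ‖x‖⁻¹ ^ (2 * m))⁻¹ =
      (c * ‖x‖ ^ 2) ^ m / m.factorial := by
    rw [mul_pow, ← pow_mul, inv_pow]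
    field_simp
  rw [h3]
  exact h2

theorem summable_gaussian_add [DiscreteTopology Λ] {c : ℝ} (hc : 0 < c)
    (v : EuclideanSpace ℝ (Fin n)) :
    Summable fun x : Λ => Real.exp (-c * ‖v + (x : EuclideanSpace ℝ (Fin n))‖ ^ 2) := by
  refine Summable.of_nonneg_of_le (fun x => by positivity) (fun x => ?_)
    ((summable_gaussian (Λ := Λ) (half_pos hc)).mul_left (Real.exp (c * ‖v‖ ^ 2)))
  rw [← Real.exp_add, Real.exp_le_exp]
  nlinarith [norm_add_sq_ge v (x : EuclideanSpace ℝ (Fin n))]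

theorem norm_cexp_gaussian (z : ℂ) (r : ℝ) :
    ‖cexp (Real.pi * I * (r : ℂ) * z)‖ = Real.exp (-(Real.pi * z.im) * r) := by
  rw [Complex.norm_exp]
  congr 1
  simp
  ring

theorem summable_cexp_gaussian_add [DiscreteTopology Λ] {z : ℂ} (hz : 0 < z.im)
    (v : EuclideanSpace ℝ (Fin n)) :
    Summable fun x : Λ =>
      cexp (Real.pi * I * ((‖v + (x : EuclideanSpace ℝ (Fin n))‖ ^ 2 : ℝ) : ℂ) * z) := by
  refine Summable.of_norm ?_
  simp_rw [norm_cexp_gaussian]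
  exact summable_gaussian_add (by positivity) v

/-- The inversion formula for theta series of shifts of unimodular lattices. -/
theorem IsUnimodular.theta_inversion (h : IsUnimodular Λ) {z : ℂ} (hz : 0 < z.im)
    (v : EuclideanSpace ℝ (Fin n)) :
    ∑' x : Λ, cexp (Real.pi * I * ((‖(x : EuclideanSpace ℝ (Fin n))‖ ^ 2 : ℝ) : ℂ) * (-1 / z)) *
      cexp (2 * Real.pi * I * ⟪(x : EuclideanSpace ℝ (Fin n)), v⟫) =
    ((-I * z) ^ (1 / 2 : ℂ)) ^ n *
      ∑' x : Λ, cexp (Real.pi * I * ((‖v + (x : EuclideanSpace ℝ (Fin n))‖ ^ 2 : ℝ) : ℂ) * z) := by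
  have := h.discrete
  have := h.isZLattice
  obtain ⟨b⟩ := h.exists_basis
  obtain ⟨e, he⟩ := h.exists_dual_equiv b
  have hz0 : z ≠ 0 := by rintro rfl; simp at hz
  set f : EuclideanSpace ℝ (Fin n) → ℂ :=
    fun x => cexp (Real.pi * I * ((‖x‖ ^ 2 : ℝ) : ℂ) * z) with hfdef
  have hf' : f = fun x => cexp (-(-Real.pi * I * z) * (‖x‖ : ℂ) ^ 2) := by
    ext x
    simp only [f]
    congr 1
    push_cast
    ring
  have hb : 0 < (-Real.pi * I * z).re := by simp; positivity
  have hhat : ∀ w, 𝓕 f w = (((-I * z) ^ (1 / 2 : ℂ)) ^ n)⁻¹ *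
      cexp (Real.pi * I * ((‖w‖ ^ 2 : ℝ) : ℂ) * (-1 / z)) := by
    intro w
    rw [hf', fourier_gaussian_innerProductSpace hb]
    congr 1
    · have h1 : (Real.pi : ℂ) / (-Real.pi * I * z) = (-I * z)⁻¹ := by
        have := Complex.ofReal_ne_zero.2 Real.pi_ne_zero
        field_simp
      rw [h1, ← Complex.cpow_nat_mul, Complex.inv_cpow]
      · simp [finrank_euclideanSpace]
        ring_nf
      · rw [Ne, Complex.arg_eq_pi_iff]
        simp
        intro hneg
        linarith
    · congr 1
      have := Complex.ofReal_ne_zero.2 Real.pi_ne_zero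
      have := I_ne_zero
      push_cast
      field_simp
      rw [I_sq]; ring
  have hs0 : ((-I * z) ^ (1 / 2 : ℂ)) ^ n ≠ 0 := by
    refine pow_ne_zero _ ?_
    rw [Ne, Complex.cpow_eq_zero_iff]
    simp [hz0]
  have him : 0 < (-1 / z).im := by
    rw [neg_div, one_div, Complex.neg_im, Complex.inv_im, neg_div, neg_neg]
    exact div_pos hz (Complex.normSq_pos.2 hz0)
  have hP := hasSum_fourier_lattice b h.covolume_eq_one e he f (by fun_prop)
    (by rw [hf']; simpa using GaussianFourier.integrable_cexp_neg_mul_sq_norm_add hb 0 (0 : EuclideanSpace ℝ (Fin n)))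
    (fun R => ⟨fun x => Real.exp (Real.pi * z.im * R ^ 2) *
      Real.exp (-(Real.pi * z.im / 2) * ‖(x : EuclideanSpace ℝ (Fin n))‖ ^ 2),
      (summable_gaussian (by positivity)).mul_left _, fun x hx l => by
        beta_reduce
        rw [norm_cexp_gaussian, ← Real.exp_add, Real.exp_le_exp]
        have h1 := norm_add_sq_ge x (l : EuclideanSpace ℝ (Fin n))
        have h2 : ‖x‖ ^ 2 ≤ R ^ 2 := by gcongr
        have h3 : 0 < Real.pi * z.im := by positivity
        nlinarith⟩)
    (by
      simp_rw [hhat]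
      refine Summable.mul_left _ ?_
      simpa using summable_cexp_gaussian_add (Λ := Λ) him 0) v
  have := hP.tsum_eq
  simp_rw [hhat, mul_assoc _ (cexp _) (cexp _)] at this
  rw [tsum_mul_left, inv_mul_eq_iff_eq_mul₀ hs0] at this
  exact this

theorem IsUnimodular.theta_neg_inv (h : IsUnimodular Λ) {z : ℂ} (hz : 0 < z.im) :
    theta Λ (-1 / z) = ((-I * z) ^ (1 / 2 : ℂ)) ^ n * theta Λ z := by
  simpa [theta] using h.theta_inversion hz 0

/-- Translation by 1 inserts the sign (-1)^(x,x), which equals (-1)^(x,w); inversion turns this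
character into a shift by w/2. -/
theorem IsUnimodular.theta_one_sub_inv (h : IsUnimodular Λ) {z : ℂ} (hz : 0 < z.im)
    {w : EuclideanSpace ℝ (Fin n)} (hw : IsCharacteristic Λ w) :
    theta Λ (1 - 1 / z) = ((-I * z) ^ (1 / 2 : ℂ)) ^ n *
      ∑' x : Λ, cexp (Real.pi * I * ((‖(2⁻¹ : ℝ) • w + (x : EuclideanSpace ℝ (Fin n))‖ ^ 2 : ℝ) : ℂ) * z) := by
  rw [← h.theta_inversion hz, theta]
  refine tsum_congr fun x => ?_
  rw [← Complex.exp_add]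
  obtain ⟨k, hk⟩ := hw.2 x x.2
  obtain ⟨m, hm⟩ := h.inner_int x x.2 x x.2
  rw [real_inner_smul_right, real_inner_comm, ← real_inner_self_eq_norm_sq, hm]
  rw [hm, sub_eq_iff_eq_add] at hk
  rw [hk, ← Complex.exp_periodic.int_mul k]
  congr 1
  push_cast
  ring

theorem theta_add_two (h : IsUnimodular Λ) (z : ℂ) : theta Λ (z + 2) = theta Λ z := by
  refine tsum_congr fun x => ?_
  obtain ⟨m, hm⟩ := h.inner_int x x.2 x x.2
  rw [← real_inner_self_eq_norm_sq, hm, ← Complex.exp_periodic.int_mul m (_ * z)]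
  congr 1
  push_cast
  ring

end Gaussian

/-! ### Vanishing of forms for the theta group -/

section Vanishing

open Complex Filter Asymptotics

theorem im_neg_one_div_pos {z : ℂ} (hz : 0 < z.im) : 0 < (-1 / z).im := by
  have hz0 : z ≠ 0 := by rintro rfl; simp at hz
  rw [neg_div, one_div, Complex.neg_im, Complex.inv_im, neg_div, neg_neg]
  exact div_pos hz (Complex.normSq_pos.2 hz0)

theorem im_one_sub_one_div_pos {z : ℂ} (hz : 0 < z.im) : 0 < (1 - 1 / z).im := by
  have := im_neg_one_div_pos hz
  rw [neg_div] at this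
  simpa [sub_eq_add_neg] using this

theorem eventually_im_pos : ∀ᶠ z : ℂ in comap im atTop, 0 < z.im :=
  tendsto_comap.eventually (eventually_gt_atTop 0)

/-- A holomorphic function on the upper half plane that is invariant under the modular group and
tends to zero at the cusp vanishes. -/
theorem eq_zero_of_invariant {f : ℂ → ℂ} (hf : DifferentiableOn ℂ f {z | 0 < z.im})
    (hT : ∀ z : ℂ, 0 < z.im → f (z + 1) = f z) (hS : ∀ z : ℂ, 0 < z.im → f (-1 / z) = f z)
    (h0 : Tendsto f (comap im atTop) (nhds 0)) {z : ℂ} (hz : 0 < z.im) : f z = 0 := by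
  set g : UpperHalfPlane → ℂ := fun τ => f τ with hg
  have h0' : Tendsto g UpperHalfPlane.atImInfty (nhds 0) := by
    refine h0.comp ?_
    rw [tendsto_comap_iff]
    exact tendsto_comap
  have hinv : ∀ γ : Matrix.SpecialLinearGroup (Fin 2) ℤ, SlashAction.map (0 : ℤ) γ g = g := by
    refine SlashInvariantForm.slash_action_generators_SL2Z ?_ ?_
    · ext τ
      rw [ModularForm.SL_slash_apply, UpperHalfPlane.modular_S_smul]
      simp only [neg_zero, zpow_zero, mul_one, hg]
      rw [← hS τ τ.im_pos]
      congr 1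
      rw [inv_neg, neg_div, one_div]
    · ext τ
      rw [ModularForm.SL_slash_apply, UpperHalfPlane.modular_T_smul]
      simp only [neg_zero, zpow_zero, mul_one, hg]
      rw [← hT τ τ.im_pos]
      congr 1
      simp [add_comm]
  let F : ModularForm (Matrix.SpecialLinearGroup.mapGL (R := ℤ) (n := Fin 2) ℝ).range 0 :=
    { toFun := g
      slash_action_eq' := by
        rintro _ ⟨γ, rfl⟩
        exact hinv γ
      holo' := by
        rw [UpperHalfPlane.mdifferentiable_iff]
        refine hf.congr fun w hw => ?_
        simp [hg, UpperHalfPlane.ofComplex_apply_of_im_pos hw]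
      bdd_at_cusps' := by
        intro c hc
        rw [Subgroup.IsArithmetic.isCusp_iff_isCusp_SL2Z] at hc
        rw [OnePoint.isBoundedAt_iff_forall_SL2Z hc]
        intro γ _
        rw [hinv γ]
        exact h0'.isBigO_one ℝ }
  obtain ⟨c, hc⟩ := ModularFormClass.levelOne_weight_zero_const F
  have hgc : g = Function.const _ c := hc
  have hc0 : c = 0 := by
    rw [hgc] at h0'
    exact tendsto_nhds_unique tendsto_const_nhds h0'
  have := congrFun hgc ⟨z, hz⟩
  simpa [hg, hc0] using this

/-- The discriminant as a function of a complex variable. -/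
noncomputable def delta (z : ℂ) : ℂ := ModularForm.eta z ^ 24

theorem delta_ne_zero {z : ℂ} (hz : 0 < z.im) : delta z ≠ 0 :=
  ModularForm.discriminant_ne_zero ⟨z, hz⟩

theorem delta_add_one {z : ℂ} (hz : 0 < z.im) : delta (z + 1) = delta z := by
  obtain ⟨τ, rfl⟩ : ∃ τ : UpperHalfPlane, (τ : ℂ) = z := ⟨⟨z, hz⟩, rfl⟩
  have h := congrFun ModularForm.discriminant_T_invariant τ
  rw [ModularForm.SL_slash_apply, UpperHalfPlane.modular_T_smul] at h
  have h1 : UpperHalfPlane.denom ModularGroup.T τ = 1 := by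
    change (((ModularGroup.T 1 0 : ℤ) : ℝ) : ℂ) * τ + (((ModularGroup.T 1 1 : ℤ) : ℝ) : ℂ) = 1
    simp [ModularGroup.coe_T]
  rw [h1, one_zpow, mul_one, ModularForm.discriminant, ModularForm.discriminant,
    UpperHalfPlane.coe_vadd, add_comm] at h
  exact_mod_cast h

theorem delta_neg_one_div {z : ℂ} (hz : 0 < z.im) : delta (-1 / z) = z ^ 12 * delta z := by
  have hz0 : z ≠ 0 := by rintro rfl; simp at hz
  obtain ⟨τ, rfl⟩ : ∃ τ : UpperHalfPlane, (τ : ℂ) = z := ⟨⟨z, hz⟩, rfl⟩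
  have h := congrFun ModularForm.discriminant_S_invariant τ
  rw [ModularForm.SL_slash_apply, UpperHalfPlane.modular_S_smul, ModularGroup.denom_S] at h
  have h' : delta (-τ : ℂ)⁻¹ * (τ : ℂ) ^ (-12 : ℤ) = delta τ := h
  rw [← h', neg_div, one_div, inv_neg, zpow_neg]
  have h0 : ((τ : ℂ) ^ (12 : ℤ)) = (τ : ℂ) ^ 12 := by norm_cast
  rw [h0]
  field_simp

theorem differentiableOn_delta : DifferentiableOn ℂ delta {z | 0 < z.im} := fun _ hz =>
  ((ModularForm.differentiableAt_eta_of_mem_upperHalfPlaneSet hz).pow 24).differentiableWithinAt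

theorem exp_isBigO_delta :
    (fun z : ℂ => Real.exp (-(2 * Real.pi) * z.im)) =O[comap im atTop] delta := by
  have h := ModularForm.exp_isBigO_discriminant.comp_tendsto
    UpperHalfPlane.tendsto_comap_im_ofComplex
  refine h.congr' ?_ ?_
  · filter_upwards [eventually_im_pos] with z hz
    simp [UpperHalfPlane.ofComplex_apply_of_im_pos hz, ← UpperHalfPlane.coe_im]
  · filter_upwards [eventually_im_pos] with z hz
    simp [UpperHalfPlane.ofComplex_apply_of_im_pos hz, ModularForm.discriminant, delta]

theorem tendsto_add_one_comap_im : Tendsto (fun z : ℂ => z + 1) (comap im atTop) (comap im atTop) := by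
  rw [tendsto_comap_iff]
  convert tendsto_comap (f := im) (x := atTop) using 1
  ext z
  simp

/-- A holomorphic form of weight `n / 2` for the theta group vanishes if its orders at the two
cusps are too large. -/
theorem eq_zero_of_theta_group {G : ℂ → ℂ} {n : ℕ} {a c : ℝ}
    (hG : DifferentiableOn ℂ G {z | 0 < z.im})
    (hT : ∀ z : ℂ, 0 < z.im → G (z + 2) = G z)
    (hS : ∀ z : ℂ, 0 < z.im → G (-1 / z) ^ 8 = z ^ (4 * n) * G z ^ 8)
    (hinf : G =O[comap im atTop] fun z => Real.exp (-a * z.im))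
    (hone : (fun z => G (1 - 1 / z) ^ 8 / z ^ (4 * n)) =O[comap im atTop]
      fun z => Real.exp (-c * z.im))
    (hac : 2 * Real.pi * n < 16 * a + c) {z : ℂ} (hz : 0 < z.im) : G z = 0 := by
  have hne : ∀ {w : ℂ}, 0 < w.im → w ≠ 0 := by rintro w hw rfl; simp at hw
  have him1 : ∀ {w : ℂ}, 0 < w.im → 0 < (w + 1).im := by intro w hw; simpa using hw
  have hU : IsOpen {z : ℂ | 0 < z.im} := UpperHalfPlane.isOpen_upperHalfPlaneSet
  have hUc : IsPreconnected {z : ℂ | 0 < z.im} := (convex_halfSpace_im_gt 0).isPreconnected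
  have hG2 : DifferentiableOn ℂ (fun z => G (z + 1)) {z | 0 < z.im} :=
    hG.comp (by fun_prop) fun w hw => him1 hw
  have hG3 : DifferentiableOn ℂ (fun z => G (1 - 1 / z)) {z | 0 < z.im} := by
    refine hG.comp (fun w hw => ?_) fun w hw => im_one_sub_one_div_pos hw
    have : DifferentiableAt ℂ (fun z : ℂ => 1 - 1 / z) w :=
      (differentiableAt_const _).sub ((differentiableAt_const _).div differentiableAt_id (hne hw))
    exact this.differentiableWithinAt
  -- The norm of G⁸ over the three cosets of the theta group in SL₂(ℤ): a form of weight 12n, so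
  -- division by Δⁿ gives weight zero. The eighth power removes square roots and roots of unity.
  set N : ℂ → ℂ := fun z => G z ^ 8 * G (z + 1) ^ 8 * (G (1 - 1 / z) ^ 8 / z ^ (4 * n)) with hN
  have key : ∀ w : ℂ, 0 < w.im → N w / delta w ^ n = 0 := by
    intro w hw
    refine eq_zero_of_invariant (f := fun w => N w / delta w ^ n) ?_ ?_ ?_ ?_ hw
    · refine DifferentiableOn.fun_div ?_ (differentiableOn_delta.fun_pow n)
        fun w hw => pow_ne_zero _ (delta_ne_zero hw)
      refine ((hG.fun_pow 8).fun_mul (hG2.fun_pow 8)).fun_mul ((hG3.fun_pow 8).fun_div ?_ ?_)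
      · fun_prop
      · exact fun w hw => pow_ne_zero _ (hne hw)
    · intro z hz
      have hz0 := hne hz
      have hz1 := hne (him1 hz)
      have h1 : G (1 - 1 / (z + 1)) ^ 8 / (z + 1) ^ (4 * n) = G (1 - 1 / z) ^ 8 / z ^ (4 * n) := by
        have h2 : 0 < (-1 - 1 / z).im := by
          have := im_one_sub_one_div_pos hz
          simpa using this
        have h3 : 1 - 1 / (z + 1) = -1 / (-1 - 1 / z) := by
          have : -1 - 1 / z ≠ 0 := hne h2
          rw [eq_div_iff this]
          field_simp
          ring
        rw [h3, hS _ h2, ← hT _ h2, show -1 - 1 / z + 2 = 1 - 1 / z by ring,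
          show -1 - 1 / z = -1 * ((z + 1) / z) by field_simp; ring, mul_pow, div_pow,
          Even.neg_one_pow ⟨2 * n, by ring⟩]
        field_simp
      simp only [hN]
      rw [h1, show z + 1 + 1 = z + 2 by ring, hT z hz, delta_add_one hz]
      ring
    · intro z hz
      have hz0 := hne hz
      have h1 : 1 - 1 / (-1 / z) = z + 1 := by field_simp; ring
      have h2 : -1 / z + 1 = 1 - 1 / z := by ring
      simp only [hN]
      rw [h1, h2, hS z hz, delta_neg_one_div hz, div_pow, Even.neg_one_pow ⟨2 * n, by ring⟩,
        mul_pow, ← pow_mul]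
      have := delta_ne_zero hz
      field_simp
      ring
    · have hb2 := hinf.comp_tendsto tendsto_add_one_comap_im
      have hbd : (fun z => (delta z ^ n)⁻¹) =O[comap im atTop]
          fun z : ℂ => (Real.exp (-(2 * Real.pi) * z.im) ^ n)⁻¹ := by
        refine (exp_isBigO_delta.pow n).inv_rev (.of_forall fun z h => ?_)
        exact absurd h (by positivity)
      have hb := (((hinf.pow 8).mul (hb2.pow 8)).mul hone).mul hbd
      refine hb.trans_tendsto ?_
      -- Decay 8a comes from each of G(z)⁸ and G(z+1)⁸ and c from the third factor; dividing by Δⁿ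
      -- costs 2πn.
      have : Tendsto (fun z : ℂ => Real.exp (-((16 * a + c - 2 * Real.pi * n) * z.im)))
          (comap im atTop) (nhds 0) := by
        refine Real.tendsto_exp_neg_atTop_nhds_zero.comp ?_
        exact tendsto_comap.const_mul_atTop (by linarith)
      refine this.congr fun z => ?_
      simp only [Function.comp, Complex.add_im, Complex.one_im, add_zero]
      rw [← Real.exp_nat_mul, ← Real.exp_nat_mul, ← Real.exp_add, ← Real.exp_add, ← Real.exp_neg,
        ← Real.exp_add]
      congr 1
      push_cast
      ring
  have key2 : ∀ w ∈ {z : ℂ | 0 < z.im}, G w * (G (w + 1) * G (1 - 1 / w)) = 0 := by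
    intro w hw
    have h1 := key w hw
    have hw0 := hne hw
    have := delta_ne_zero hw
    simp only [hN, div_eq_zero_iff, mul_eq_zero, pow_eq_zero_iff', ne_eq, hw0, this, false_and,
      or_false] at h1
    simp only [mul_eq_zero]
    tauto
  -- By the identity theorem one factor vanishes identically, and each factor is G after a bijective
  -- change of variable.
  rcases (hG.analyticOnNhd hU).eq_zero_or_eq_zero_of_mul_eq_zero
    ((hG2.fun_mul hG3).analyticOnNhd hU) key2 hUc with h | h
  · exact h z hz
  rcases (hG2.analyticOnNhd hU).eq_zero_or_eq_zero_of_mul_eq_zero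
    (hG3.analyticOnNhd hU) h hUc with h | h
  · rw [← hT z hz, show z + 2 = (z + 1) + 1 by ring]
    exact h (z + 1) (him1 hz)
  · have hz2 : 0 < (z - 1).im := by simpa using hz
    have := h (-1 / (z - 1)) (im_neg_one_div_pos hz2)
    have h0 := hne hz2
    rwa [show 1 - 1 / (-1 / (z - 1)) = z by field_simp; ring] at this

end Vanishing

/-! ### Expansions modulo q⁵ of the theta constants -/

section Expansions

open Complex Filter Asymptotics

/-- The local parameter `q = exp(π i z)`. -/
noncomputable def qexp (z : ℂ) : ℂ := cexp (Real.pi * I * z)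

theorem norm_qexp (z : ℂ) : ‖qexp z‖ = Real.exp (-(Real.pi * z.im)) := by
  rw [qexp, Complex.norm_exp]
  congr 1
  simp

theorem qexp_pow (z : ℂ) (k : ℕ) : qexp z ^ k = cexp (Real.pi * I * k * z) := by
  rw [qexp, ← Complex.exp_nat_mul]
  ring_nf

theorem qexp_add_one (z : ℂ) : qexp (z + 1) = -qexp z := by
  rw [qexp, mul_add, Complex.exp_add, mul_one, Complex.exp_pi_mul_I, qexp]
  ring

theorem qexp_isBigO_pow (k : ℕ) :
    (fun z => qexp z ^ k) =O[comap im atTop] fun z => Real.exp (-(k * Real.pi) * z.im) := by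
  refine .of_bound 1 (.of_forall fun z => ?_)
  rw [norm_pow, norm_qexp, ← Real.exp_nat_mul, Real.norm_of_nonneg (Real.exp_pos _).le, one_mul]
  refine le_of_eq ?_
  ring_nf

theorem exp_isBigO_exp {a b : ℝ} (h : b ≤ a) :
    (fun z : ℂ => Real.exp (-a * z.im)) =O[comap im atTop] fun z => Real.exp (-b * z.im) := by
  refine .of_bound 1 ?_
  filter_upwards [eventually_im_pos] with z hz
  rw [Real.norm_of_nonneg (Real.exp_pos _).le, Real.norm_of_nonneg (Real.exp_pos _).le, one_mul,
    Real.exp_le_exp]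
  nlinarith

theorem qexp_isBigO_one : qexp =O[comap im atTop] fun _ => (1 : ℝ) := by
  have := (qexp_isBigO_pow 1).trans (exp_isBigO_exp (b := 0) (by positivity))
  simpa using this

/-- `f = a₀ + a₁ q + a₂ q² + a₃ q³ + a₄ q⁴ + O(q⁵)` at the cusp `i∞`. -/
def QExp (f : ℂ → ℂ) (a₀ a₁ a₂ a₃ a₄ : ℂ) : Prop :=
  (fun z => f z - (a₀ + a₁ * qexp z + a₂ * qexp z ^ 2 + a₃ * qexp z ^ 3 + a₄ * qexp z ^ 4))
    =O[comap im atTop] fun z => Real.exp (-(5 * Real.pi) * z.im)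

variable {f g : ℂ → ℂ} {a₀ a₁ a₂ a₃ a₄ b₀ b₁ b₂ b₃ b₄ : ℂ}

theorem poly_qexp_isBigO_one (a₀ a₁ a₂ a₃ a₄ : ℂ) :
    (fun z => a₀ + a₁ * qexp z + a₂ * qexp z ^ 2 + a₃ * qexp z ^ 3 + a₄ * qexp z ^ 4)
      =O[comap im atTop] fun _ => (1 : ℝ) := by
  have h (a : ℂ) (k : ℕ) : (fun z => a * qexp z ^ k) =O[comap im atTop] fun _ => (1 : ℝ) := by
    simpa using (qexp_isBigO_one.pow k).const_mul_left a
  simpa using ((((h a₀ 0).add (h a₁ 1)).add (h a₂ 2)).add (h a₃ 3)).add (h a₄ 4)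

theorem QExp.isBigO_one (hf : QExp f a₀ a₁ a₂ a₃ a₄) : f =O[comap im atTop] fun _ => (1 : ℝ) := by
  have h1 : (fun z : ℂ => Real.exp (-(5 * Real.pi) * z.im)) =O[comap im atTop] fun _ => (1 : ℝ) := by
    simpa using exp_isBigO_exp (a := 5 * Real.pi) (b := 0) (by positivity)
  simpa using (IsBigO.trans hf h1).add (poly_qexp_isBigO_one a₀ a₁ a₂ a₃ a₄)

theorem QExp.tendsto (hf : QExp f a₀ a₁ a₂ a₃ a₄) : Tendsto f (comap im atTop) (nhds a₀) := by
  have h5 : Tendsto (fun z : ℂ => Real.exp (-(5 * Real.pi) * z.im)) (comap im atTop) (nhds 0) := by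
    refine (Real.tendsto_exp_neg_atTop_nhds_zero.comp
      ((tendsto_comap (f := im) (x := atTop)).const_mul_atTop
        (show 0 < 5 * Real.pi by positivity))).congr fun z => ?_
    simp
  have hq : Tendsto qexp (comap im atTop) (nhds 0) := by
    rw [tendsto_zero_iff_norm_tendsto_zero]
    refine (Real.tendsto_exp_neg_atTop_nhds_zero.comp
      ((tendsto_comap (f := im) (x := atTop)).const_mul_atTop Real.pi_pos)).congr fun z => ?_
    simp [norm_qexp]
  have h1 := hf.trans_tendsto h5
  have h2 : Tendsto (fun z => a₀ + a₁ * qexp z + a₂ * qexp z ^ 2 + a₃ * qexp z ^ 3 +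
      a₄ * qexp z ^ 4) (comap im atTop) (nhds (a₀ + a₁ * 0 + a₂ * 0 ^ 2 + a₃ * 0 ^ 3 + a₄ * 0 ^ 4)) :=
    (((tendsto_const_nhds.add (hq.const_mul _)).add ((hq.pow 2).const_mul _)).add
      ((hq.pow 3).const_mul _)).add ((hq.pow 4).const_mul _)
  simpa using h1.add h2

theorem QExp.add (hf : QExp f a₀ a₁ a₂ a₃ a₄) (hg : QExp g b₀ b₁ b₂ b₃ b₄) :
    QExp (fun z => f z + g z) (a₀ + b₀) (a₁ + b₁) (a₂ + b₂) (a₃ + b₃) (a₄ + b₄) := by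
  refine (IsBigO.add hf hg).congr_left fun z => ?_
  ring

theorem QExp.mul (hf : QExp f a₀ a₁ a₂ a₃ a₄) (hg : QExp g b₀ b₁ b₂ b₃ b₄) :
    QExp (fun z => f z * g z) (a₀ * b₀) (a₀ * b₁ + a₁ * b₀) (a₀ * b₂ + a₁ * b₁ + a₂ * b₀)
      (a₀ * b₃ + a₁ * b₂ + a₂ * b₁ + a₃ * b₀)
      (a₀ * b₄ + a₁ * b₃ + a₂ * b₂ + a₃ * b₁ + a₄ * b₀) := by
  have h1 := IsBigO.mul hf hg.isBigO_one
  have h2 := (poly_qexp_isBigO_one a₀ a₁ a₂ a₃ a₄).mul hg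
  -- The terms of degree 5 to 8 in the product of the two truncations.
  have h3 := (qexp_isBigO_pow 5).mul (poly_qexp_isBigO_one
    (a₁ * b₄ + a₂ * b₃ + a₃ * b₂ + a₄ * b₁) (a₂ * b₄ + a₃ * b₃ + a₄ * b₂) (a₃ * b₄ + a₄ * b₃)
    (a₄ * b₄) 0)
  simp only [one_mul, mul_one] at h1 h2 h3
  refine ((h1.add h2).add h3).congr_left fun z => ?_
  ring

theorem QExp.const_mul (c : ℂ) (hf : QExp f a₀ a₁ a₂ a₃ a₄) :
    QExp (fun z => c * f z) (c * a₀) (c * a₁) (c * a₂) (c * a₃) (c * a₄) := by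
  refine (IsBigO.const_mul_left hf c).congr_left fun z => ?_
  ring

theorem qExp_one : QExp (fun _ => 1) 1 0 0 0 0 := by
  refine (isBigO_zero _ _).congr_left fun z => ?_
  simp

theorem qExp_qexp : QExp qexp 0 1 0 0 0 := by
  refine (isBigO_zero _ _).congr_left fun z => ?_
  simp

/-- Exponential series are bounded by their leading exponent. -/
theorem tsum_cexp_isBigO {ι : Type*} (c : ι → ℂ) (e : ι → ℝ) (r : ℝ)
    (hs : Summable fun i => Real.exp (-Real.pi * e i)) (hc : ∀ i, ‖c i‖ ≤ 1)
    (hr : ∀ i, c i ≠ 0 → r ≤ e i) :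
    (fun z => ∑' i, c i * cexp (Real.pi * I * (e i : ℂ) * z)) =O[comap im atTop]
      fun z => Real.exp (-(Real.pi * r) * z.im) := by
  -- For y = Im z ≥ 1, (e i - r)(y - 1) ≥ 0 bounds each term by its value at y = 1 times exp(-πr(y -
  -- 1)).
  refine .of_bound (Real.exp (Real.pi * r) * ∑' i, Real.exp (-Real.pi * e i)) ?_
  filter_upwards [tendsto_comap.eventually (eventually_ge_atTop 1)] with z hz
  rw [Real.norm_of_nonneg (Real.exp_pos _).le, ← tsum_mul_left, ← tsum_mul_right]
  refine tsum_of_norm_bounded ((hs.mul_left _).mul_right _).hasSum fun i => ?_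
  rw [norm_mul, norm_cexp_gaussian]
  by_cases h0 : c i = 0
  · rw [h0, norm_zero, zero_mul]
    positivity
  refine (mul_le_of_le_one_left (Real.exp_pos _).le (hc i)).trans ?_
  rw [← Real.exp_add, ← Real.exp_add, Real.exp_le_exp]
  nlinarith [mul_nonneg (mul_nonneg Real.pi_pos.le (sub_nonneg.2 (hr i h0))) (sub_nonneg.2 hz)]

theorem summable_exp_neg_pi_nat (e : ℕ → ℝ) (he : ∀ i : ℕ, (i : ℝ) ≤ e i) :
    Summable fun i : ℕ => Real.exp (-Real.pi * e i) := by
  refine Summable.of_nonneg_of_le (fun i => by positivity) (fun i => ?_)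
    (Real.summable_exp_nat_mul_iff.2 (neg_lt_zero.2 Real.pi_pos))
  rw [Real.exp_le_exp]
  nlinarith [he i, Real.pi_pos]

theorem qExp_jacobiTheta : QExp jacobiTheta 1 2 0 0 2 := by
  have h := tsum_cexp_isBigO (fun _ : ℕ => 1) (fun i : ℕ => ((i : ℝ) + 3) ^ 2) 5
    (summable_exp_neg_pi_nat _ fun i => by nlinarith [(Nat.cast_nonneg i : (0 : ℝ) ≤ i)])
    (by simp) (fun i _ => by nlinarith [(Nat.cast_nonneg i : (0 : ℝ) ≤ i)])
  refine ((h.const_mul_left 2).congr' ?_ (.of_forall fun z => by ring_nf))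
  filter_upwards [eventually_im_pos] with z hz
  have h1 := hasSum_nat_jacobiTheta hz
  have h2 := h1.summable.sum_add_tsum_nat_add 2
  rw [h1.tsum_eq] at h2
  have h3 : ∑' i : ℕ, 1 * cexp (Real.pi * I * ((((i : ℝ) + 3) ^ 2 : ℝ) : ℂ) * z) =
      ∑' i : ℕ, cexp (Real.pi * I * ((i + 2 : ℕ) + 1 : ℂ) ^ 2 * z) := by
    refine tsum_congr fun i => ?_
    push_cast
    ring_nf
  have h4 : cexp (Real.pi * I * ((0 : ℕ) + 1 : ℂ) ^ 2 * z) = qexp z := by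
    rw [qexp]
    push_cast
    ring_nf
  have h5 : cexp (Real.pi * I * ((1 : ℕ) + 1 : ℂ) ^ 2 * z) = qexp z ^ 4 := by
    rw [qexp_pow]
    push_cast
    ring_nf
  rw [Finset.sum_range_succ, Finset.sum_range_one, h4, h5, ← h3] at h2
  linear_combination 2 * h2

/-- The theta series `∑ q^(n² + n)`. -/
noncomputable def psi (z : ℂ) : ℂ := jacobiTheta₂ (z / 2) z

theorem hasSum_psi {z : ℂ} (hz : 0 < z.im) :
    HasSum (fun i : ℕ => cexp (Real.pi * I * (i ^ 2 + i) * z)) (psi z / 2) := by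
  -- The indices k and -k-1 have the same exponent k² + k, whence the factor 2.
  have h := (hasSum_jacobiTheta₂_term (z / 2) hz).nat_add_neg_add_one.div_const 2
  refine h.congr_fun fun i => ?_
  have h1 : jacobiTheta₂_term i (z / 2) z = cexp (Real.pi * I * (i ^ 2 + i) * z) := by
    rw [jacobiTheta₂_term]
    congr 1
    push_cast
    ring
  have h2 : jacobiTheta₂_term (-(i + 1)) (z / 2) z = cexp (Real.pi * I * (i ^ 2 + i) * z) := by
    rw [jacobiTheta₂_term]
    congr 1
    push_cast
    ring
  rw [h1, h2]
  ring

theorem psi_add_one {z : ℂ} (hz : 0 < z.im) : psi (z + 1) = psi z := by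
  have hz1 : 0 < (z + 1).im := by simpa using hz
  have h : psi (z + 1) / 2 = psi z / 2 := by
    refine (hasSum_psi hz1).unique ((hasSum_psi hz).congr_fun fun i => ?_)
    obtain ⟨k, hk⟩ : Even (i * (i + 1)) := Nat.even_mul_succ_self i
    rw [← Complex.exp_periodic.int_mul k (_ * z)]
    congr 1
    have hk' : (i : ℂ) * (i + 1) = k + k := by exact_mod_cast hk
    push_cast
    linear_combination (Real.pi * I) * hk'
  linear_combination 2 * h

theorem qExp_psi : QExp psi 2 0 2 0 0 := by
  have h := tsum_cexp_isBigO (fun _ : ℕ => 1) (fun i : ℕ => ((i : ℝ) + 2) ^ 2 + (i + 2)) 5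
    (summable_exp_neg_pi_nat _ fun i => by nlinarith [(Nat.cast_nonneg i : (0 : ℝ) ≤ i)])
    (by simp) (fun i _ => by nlinarith [(Nat.cast_nonneg i : (0 : ℝ) ≤ i)])
  refine ((h.const_mul_left 2).congr' ?_ (.of_forall fun z => by ring_nf))
  filter_upwards [eventually_im_pos] with z hz
  have h1 := hasSum_psi hz
  have h2 := h1.summable.sum_add_tsum_nat_add 2
  rw [h1.tsum_eq] at h2
  have h3 : ∑' i : ℕ, 1 * cexp (Real.pi * I * ((((i : ℝ) + 2) ^ 2 + (i + 2) : ℝ) : ℂ) * z) =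
      ∑' i : ℕ, cexp (Real.pi * I * (((i + 2 : ℕ) : ℂ) ^ 2 + (i + 2 : ℕ)) * z) := by
    refine tsum_congr fun i => ?_
    push_cast
    ring_nf
  have h4 : cexp (Real.pi * I * (((0 : ℕ) : ℂ) ^ 2 + (0 : ℕ)) * z) = 1 := by simp
  have h5 : cexp (Real.pi * I * (((1 : ℕ) : ℂ) ^ 2 + (1 : ℕ)) * z) = qexp z ^ 2 := by
    rw [qexp_pow]
    push_cast
    ring_nf
  rw [Finset.sum_range_succ, Finset.sum_range_one, h4, h5, ← h3] at h2
  linear_combination 2 * h2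

/-- The theta series `∑ (-1)ⁿ q^(n²)`. -/
noncomputable def theta4 (z : ℂ) : ℂ := jacobiTheta (z + 1)

theorem qExp_theta4 : QExp theta4 1 (-2) 0 0 2 := by
  have h := qExp_jacobiTheta.comp_tendsto tendsto_add_one_comap_im
  refine h.congr (fun z => ?_) (fun z => by simp)
  simp only [Function.comp, qexp_add_one, theta4]
  ring

/-- The form `θ₂⁴ θ₄⁴ / 16` of weight four for the theta group. -/
noncomputable def delta8 (z : ℂ) : ℂ := qexp z * psi z ^ 4 * theta4 z ^ 4 / 16

theorem qExp_delta8 : QExp delta8 0 1 (-8) 28 (-64) := by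
  have h1 := qExp_psi.mul qExp_psi
  have h2 := qExp_theta4.mul qExp_theta4
  have h3 := ((qExp_qexp.mul (h1.mul h1)).mul (h2.mul h2)).const_mul (1 / 16)
  convert h3 using 1
  · ext z
    rw [delta8]
    ring
  all_goals norm_num

/-- The binomial terms 2^k C(m, k) of (1 + 2q)^m, with 2m added at q⁴ from the term 2q⁴ of θ₃. -/
theorem qExp_jacobiTheta_pow (m : ℕ) : QExp (fun z => jacobiTheta z ^ m) 1 (2 * m)
    (2 * m * (m - 1)) (4 / 3 * m * (m - 1) * (m - 2))
    (2 / 3 * m * (m - 1) * (m - 2) * (m - 3) + 2 * m) := by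
  induction m with
  | zero => simpa using qExp_one
  | succ m ih =>
    convert ih.mul qExp_jacobiTheta using 1
    · ext z
      exact pow_succ _ _
    all_goals (push_cast; ring)

end Expansions

/-! ### Behaviour of θ₂, θ₃, θ₄ and Δ₈ under the modular group -/

section Transformations

open Complex Filter Asymptotics

/-- The automorphy factor of weight one half. -/
noncomputable def autFactor (z : ℂ) : ℂ := (-I * z) ^ (1 / 2 : ℂ)

theorem autFactor_sq (z : ℂ) : autFactor z ^ 2 = -I * z := by
  rw [autFactor, ← Complex.cpow_nat_mul]
  norm_num

theorem autFactor_pow_eight (z : ℂ) : autFactor z ^ 8 = z ^ 4 := by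
  rw [show 8 = 2 * 4 by norm_num, pow_mul, autFactor_sq, mul_pow, neg_pow, I_pow_four]
  norm_num

theorem autFactor_ne_zero {z : ℂ} (hz : 0 < z.im) : autFactor z ≠ 0 := by
  intro h
  have := autFactor_sq z
  rw [h] at this
  have hz0 : z = 0 := by simpa using this
  simp [hz0] at hz

theorem jacobiTheta_neg_one_div {z : ℂ} (hz : 0 < z.im) :
    jacobiTheta (-1 / z) = autFactor z * jacobiTheta z := by
  have h := jacobiTheta₂_functional_equation 0 z
  have := autFactor_ne_zero hz
  rw [jacobiTheta_eq_jacobiTheta₂ z, jacobiTheta_eq_jacobiTheta₂, h]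
  rw [← autFactor]
  field_simp
  simp

theorem jacobiTheta_add_two (z : ℂ) : jacobiTheta (z + 2) = jacobiTheta z := by
  rw [add_comm, jacobiTheta_two_add]

theorem theta4_eq_jacobiTheta₂ (z : ℂ) : theta4 z = jacobiTheta₂ (1 / 2) z := by
  rw [theta4, jacobiTheta, jacobiTheta₂]
  refine tsum_congr fun k => ?_
  rw [jacobiTheta₂_term]
  obtain ⟨l, hl⟩ : Even (k * (k - 1)) := Int.even_mul_pred_self k
  rw [← Complex.exp_periodic.int_mul l (_ + _)]
  congr 1
  have hl' : (k : ℂ) * (k - 1) = l + l := by exact_mod_cast hl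
  linear_combination (Real.pi * I) * hl'

/-- Inversion exchanges θ₄ and θ₂; hence θ₂⁴θ₄⁴ is preserved up to its weight. -/
theorem theta4_neg_one_div {z : ℂ} (hz : 0 < z.im) :
    theta4 (-1 / z) = autFactor z * (cexp (Real.pi * I * z / 4) * psi z) := by
  have h := jacobiTheta₂_functional_equation (z / 2) z
  have h0 := autFactor_ne_zero hz
  have hz0 : z ≠ 0 := by rintro rfl; simp at hz
  rw [← autFactor, show z / 2 / z = 1 / 2 by field_simp, ← theta4_eq_jacobiTheta₂,
    show -Real.pi * I * (z / 2) ^ 2 / z = -(Real.pi * I * z / 4) by field_simp; ring,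
    Complex.exp_neg] at h
  rw [psi, h]
  have := Complex.exp_ne_zero (Real.pi * I * z / 4)
  field_simp

theorem cexp_mul_psi_neg_one_div {z : ℂ} (hz : 0 < z.im) :
    cexp (Real.pi * I * (-1 / z) / 4) * psi (-1 / z) = autFactor z * theta4 z := by
  have h := jacobiTheta₂_functional_equation (1 / 2) z
  have h0 := autFactor_ne_zero hz
  have hz0 : z ≠ 0 := by rintro rfl; simp at hz
  rw [theta4_eq_jacobiTheta₂, h, psi, ← autFactor,
    show 1 / 2 / z = -(-1 / z / 2) by field_simp, jacobiTheta₂_neg_left,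
    show -Real.pi * I * (1 / 2) ^ 2 / z = Real.pi * I * (-1 / z) / 4 by field_simp; ring]
  field_simp

theorem delta8_eq (z : ℂ) :
    delta8 z = (cexp (Real.pi * I * z / 4) * psi z) ^ 4 * theta4 z ^ 4 / 16 := by
  have h : cexp (Real.pi * I * z / 4) ^ 4 = qexp z := by
    rw [← Complex.exp_nat_mul, qexp]
    congr 1
    push_cast
    ring
  rw [delta8, mul_pow _ (psi z), h]

theorem delta8_neg_one_div {z : ℂ} (hz : 0 < z.im) :
    delta8 (-1 / z) = autFactor z ^ 8 * delta8 z := by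
  rw [delta8_eq, cexp_mul_psi_neg_one_div hz, theta4_neg_one_div hz, delta8_eq]
  ring

theorem theta4_add_two (z : ℂ) : theta4 (z + 2) = theta4 z := by
  rw [theta4, show z + 2 + 1 = z + 1 + 2 by ring, jacobiTheta_add_two, theta4]

theorem delta8_add_two {z : ℂ} (hz : 0 < z.im) : delta8 (z + 2) = delta8 z := by
  have hz1 : 0 < (z + 1).im := by simpa using hz
  rw [delta8, theta4_add_two, show z + 2 = z + 1 + 1 by ring, psi_add_one hz1, psi_add_one hz,
    qexp_add_one, qexp_add_one, neg_neg, delta8]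

theorem jacobiTheta_one_sub_one_div {z : ℂ} (hz : 0 < z.im) :
    jacobiTheta (1 - 1 / z) = autFactor z * (cexp (Real.pi * I * z / 4) * psi z) := by
  rw [← theta4_neg_one_div hz, theta4]
  congr 1
  ring

/-- At the cusp 1 the pair θ₂, θ₄ becomes θ₄, θ₃ up to factors. Thus Δ₈ does not vanish there, and
all vanishing of the Hecke forms comes from powers of θ₃. -/
theorem delta8_one_sub_one_div {z : ℂ} (hz : 0 < z.im) :
    delta8 (1 - 1 / z) = -autFactor z ^ 8 * (jacobiTheta z ^ 4 * theta4 z ^ 4 / 16) := by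
  have h1 : 1 - 1 / z = -1 / z + 1 := by ring
  have h2 : theta4 (1 - 1 / z) = autFactor z * jacobiTheta z := by
    rw [theta4, show 1 - 1 / z + 1 = -1 / z + 2 by ring, jacobiTheta_add_two,
      jacobiTheta_neg_one_div hz]
  have h3 : qexp (-1 / z) * psi (-1 / z) ^ 4 = (autFactor z * theta4 z) ^ 4 := by
    rw [← cexp_mul_psi_neg_one_div hz, mul_pow, ← Complex.exp_nat_mul, qexp]
    congr 2
    push_cast
    ring
  rw [delta8, h2, h1, psi_add_one (im_neg_one_div_pos hz), qexp_add_one]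
  linear_combination (-(autFactor z * jacobiTheta z) ^ 4 / 16) * h3

theorem differentiableOn_jacobiTheta : DifferentiableOn ℂ jacobiTheta {z | 0 < z.im} :=
  fun _ hz => (differentiableAt_jacobiTheta hz).differentiableWithinAt

theorem differentiableOn_theta4 : DifferentiableOn ℂ theta4 {z | 0 < z.im} :=
  differentiableOn_jacobiTheta.comp (by fun_prop) fun z hz => by simpa using hz

theorem differentiableOn_psi : DifferentiableOn ℂ psi {z | 0 < z.im} := by
  intro z hz
  have h := (hasFDerivAt_jacobiTheta₂ (z / 2) hz).differentiableAt
  have h2 : DifferentiableAt ℂ (fun z : ℂ => (z / 2, z)) z := by fun_prop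
  have h3 := DifferentiableAt.comp (g := fun p : ℂ × ℂ => jacobiTheta₂ p.1 p.2)
    (f := fun z : ℂ => (z / 2, z)) z h h2
  exact h3.differentiableWithinAt

theorem differentiableOn_delta8 : DifferentiableOn ℂ delta8 {z | 0 < z.im} := by
  have hq : DifferentiableOn ℂ qexp {z | 0 < z.im} := by
    unfold qexp
    fun_prop
  exact ((hq.fun_mul (differentiableOn_psi.fun_pow 4)).fun_mul
    (differentiableOn_theta4.fun_pow 4)).div_const 16

end Transformations

/-! ### Holomorphy and initial coefficients of the lattice theta series -/

section Lattice

open Complex Filter Asymptotics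
variable {n : ℕ} {Λ : Submodule ℤ (EuclideanSpace ℝ (Fin n))}

theorem differentiableOn_theta [DiscreteTopology Λ] :
    DifferentiableOn ℂ (theta Λ) {z | 0 < z.im} := by
  intro z hz
  have hz' : 0 < z.im := hz
  have hU : IsOpen {w : ℂ | z.im / 2 < w.im} := isOpen_lt continuous_const Complex.continuous_im
  have h : DifferentiableOn ℂ (theta Λ) {w : ℂ | z.im / 2 < w.im} := by
    refine differentiableOn_tsum_of_summable_norm
      (summable_gaussian (Λ := Λ) (c := Real.pi * (z.im / 2)) (by positivity))
      (fun x => by fun_prop) hU fun x w hw => ?_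
    rw [norm_cexp_gaussian, Real.exp_le_exp]
    have : z.im / 2 ≤ w.im := le_of_lt hw
    have h1 : 0 ≤ Real.pi * ‖(x : EuclideanSpace ℝ (Fin n))‖ ^ 2 := by positivity
    nlinarith
  refine (h.differentiableAt (hU.mem_nhds ?_)).differentiableWithinAt
  change z.im / 2 < z.im
  linarith

/-- The theta series of a lattice without vectors of norm one, two and three. -/
theorem IsUnimodular.qExp_theta (h : IsUnimodular Λ)
    (hmin : ∀ x ∈ Λ, x ≠ 0 → 3 < (inner ℝ x x : ℝ)) :
    ∃ A : ℝ, 0 ≤ A ∧ QExp (theta Λ) 1 0 0 0 A := by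
  classical
  have := h.discrete
  set N : Λ → ℝ := fun x => ‖(x : EuclideanSpace ℝ (Fin n))‖ ^ 2 with hN
  have hs := summable_gaussian (Λ := Λ) Real.pi_pos
  have hsA : Summable fun x : Λ => if N x = 4 then (1 : ℝ) else 0 := by
    refine Summable.of_nonneg_of_le (fun x => by split_ifs <;> norm_num) (fun x => ?_)
      (hs.mul_left (Real.exp (Real.pi * 4)))
    rw [← Real.exp_add]
    split_ifs with hx
    · simp only [hN] at hx
      rw [hx]
      simp
    · positivity
  refine ⟨∑' x : Λ, if N x = 4 then (1 : ℝ) else 0,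
    tsum_nonneg fun x => by split_ifs <;> norm_num, ?_⟩
  -- Apart from 0 and the vectors of norm 4, all norms are integers above 3 and different from 4, so
  -- at least 5.
  have hmain := tsum_cexp_isBigO (fun x : Λ => if x = 0 ∨ N x = 4 then 0 else 1) N 5 hs
    (fun x => by split_ifs <;> simp) (fun x hx => by
      have hx' : ¬ (x = 0 ∨ N x = 4) := fun hc => hx (by simp [hc])
      push Not at hx'
      obtain ⟨m, hm⟩ := h.inner_int x x.2 x x.2
      have h3 := hmin x x.2 (by simpa using hx'.1)
      rw [hm] at h3
      have h4 : N x = m := by rw [hN, ← hm, real_inner_self_eq_norm_sq]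
      have h5 := hx'.2
      rw [h4] at h5 ⊢
      have h6 : (3 : ℤ) < m := by exact_mod_cast h3
      have h7 : m ≠ 4 := by rintro rfl; norm_num at h5
      have h8 : 5 ≤ m := by omega
      exact_mod_cast h8)
  refine hmain.congr' ?_ (.of_forall fun z => by ring_nf)
  filter_upwards [eventually_im_pos] with z hz
  have hS : HasSum (fun x : Λ => cexp (Real.pi * I * (N x : ℂ) * z)) (theta Λ z) := by
    have := summable_cexp_gaussian_add (Λ := Λ) hz 0
    simp only [zero_add] at this
    exact this.hasSum
  have h0 : HasSum (fun x : Λ => if x = 0 then (1 : ℂ) else 0) 1 := hasSum_ite_eq 0 1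
  have h4 : HasSum (fun x : Λ => (((if N x = 4 then (1 : ℝ) else 0) : ℝ) : ℂ) * qexp z ^ 4)
      (((∑' x : Λ, if N x = 4 then (1 : ℝ) else 0 : ℝ) : ℂ) * qexp z ^ 4) :=
    (Complex.hasSum_ofReal.2 hsA.hasSum).mul_right _
  have h5 := ((hS.sub h0).sub h4).tsum_eq
  simp only [zero_mul, add_zero]
  rw [← sub_sub, ← h5]
  refine tsum_congr fun x => ?_
  by_cases hx0 : x = 0
  · simp [hx0, hN]
  by_cases hx4 : N x = 4
  · simp only [hx0, hx4, qexp_pow]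
    simp
  · simp [hx0, hx4]

end Lattice

/-! ### The theta series as a polynomial in θ₃ and Δ₈ -/

section Hecke

open Complex Filter Asymptotics

/-- The combination `∑ⱼ bⱼ θ^(m + 32 - 8j) Δ₈^j` with `j ≤ 4`. -/
noncomputable def heckePoly (m : ℕ) (b₀ b₁ b₂ b₃ b₄ : ℂ) (t d : ℂ) : ℂ :=
  t ^ m * (b₀ * t ^ 32 + b₁ * (t ^ 24 * d) + b₂ * (t ^ 16 * d ^ 2) + b₃ * (t ^ 8 * d ^ 3) +
    b₄ * d ^ 4)

/-- All terms are homogeneous of degree m + 32 when `t` has degree 1 and `d` degree 8, so the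
combination transforms like the lattice theta series. -/
theorem heckePoly_smul (m : ℕ) (b₀ b₁ b₂ b₃ b₄ t d s : ℂ) :
    heckePoly m b₀ b₁ b₂ b₃ b₄ (s * t) (s ^ 8 * d) =
      s ^ (m + 32) * heckePoly m b₀ b₁ b₂ b₃ b₄ t d := by
  simp only [heckePoly]
  ring

variable {m : ℕ} {Λ : Submodule ℤ (EuclideanSpace ℝ (Fin (m + 32)))}

/-- Every w + 2x is again characteristic, so w/2 + x has norm at least (n - 32)/4 = m/4. -/
theorem shadow_isBigO (h : IsNSubLattice 4 Λ) {w : EuclideanSpace ℝ (Fin (m + 32))}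
    (hw : IsCharacteristic Λ w) :
    (fun z => ∑' x : Λ, cexp (Real.pi * I *
      ((‖(2⁻¹ : ℝ) • w + (x : EuclideanSpace ℝ (Fin (m + 32)))‖ ^ 2 : ℝ) : ℂ) * z))
      =O[comap im atTop] fun z => Real.exp (-(Real.pi * (m / 4)) * z.im) := by
  have := h.1.discrete
  have hmain := tsum_cexp_isBigO (fun _ : Λ => 1)
    (fun x : Λ => ‖(2⁻¹ : ℝ) • w + (x : EuclideanSpace ℝ (Fin (m + 32)))‖ ^ 2) (m / 4)
    (summable_gaussian_add Real.pi_pos _) (by simp) fun x _ => by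
      have hc : IsCharacteristic Λ (w + (2 : ℝ) • (x : EuclideanSpace ℝ (Fin (m + 32)))) := by
        refine ⟨?_, fun v hv => ?_⟩
        · rw [two_smul]
          exact Λ.add_mem hw.1 (Λ.add_mem x.2 x.2)
        · obtain ⟨k, hk⟩ := hw.2 v hv
          obtain ⟨l, hl⟩ := h.1.inner_int x x.2 v hv
          refine ⟨k + l, ?_⟩
          rw [inner_add_left, real_inner_smul_left, hl]
          push_cast
          linarith
      have h1 := h.2 _ hc
      have h2 : w + (2 : ℝ) • (x : EuclideanSpace ℝ (Fin (m + 32))) =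
          (2 : ℝ) • ((2⁻¹ : ℝ) • w + (x : EuclideanSpace ℝ (Fin (m + 32)))) := by
        rw [smul_add, smul_smul]
        norm_num
      rw [h2, real_inner_self_eq_norm_sq, norm_smul, mul_pow] at h1
      norm_num at h1
      linarith
  simpa only [one_mul] using hmain

/-- Stopping at j = 4 leaves the common factor θ₂^m, which carries q^(m/4); the rest is bounded. -/
theorem heckePoly_isBigO (b₀ b₁ b₂ b₃ b₄ : ℂ) :
    (fun z => heckePoly m b₀ b₁ b₂ b₃ b₄ (cexp (Real.pi * I * z / 4) * psi z)
      (-(jacobiTheta z ^ 4 * theta4 z ^ 4 / 16)))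
      =O[comap im atTop] fun z => Real.exp (-(Real.pi * (m / 4)) * z.im) := by
  have he (k : ℕ) : (fun z => cexp (Real.pi * I * z / 4) ^ k) =O[comap im atTop]
      fun z => Real.exp (-(Real.pi * (k / 4)) * z.im) := by
    refine .of_bound 1 (.of_forall fun z => le_of_eq ?_)
    rw [one_mul, Real.norm_of_nonneg (Real.exp_pos _).le, norm_pow, Complex.norm_exp,
      ← Real.exp_nat_mul]
    congr 1
    simp
    ring
  have ht : (fun z => cexp (Real.pi * I * z / 4) * psi z) =O[comap im atTop] fun _ => (1 : ℝ) := by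
    have h1 : (fun z => cexp (Real.pi * I * z / 4)) =O[comap im atTop] fun _ => (1 : ℝ) := by
      simpa using (he 1).trans (exp_isBigO_exp (b := 0) (by positivity))
    simpa using h1.mul qExp_psi.isBigO_one
  have hd : (fun z => -(jacobiTheta z ^ 4 * theta4 z ^ 4 / 16)) =O[comap im atTop]
      fun _ => (1 : ℝ) := by
    have := ((qExp_jacobiTheta.isBigO_one.pow 4).mul
      (qExp_theta4.isBigO_one.pow 4)).const_mul_left (-1 / 16)
    refine this.congr (fun z => ?_) fun z => by simp
    ring
  have hterm (b : ℂ) (i j : ℕ) : (fun z => b * ((cexp (Real.pi * I * z / 4) * psi z) ^ i *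
      (-(jacobiTheta z ^ 4 * theta4 z ^ 4 / 16)) ^ j)) =O[comap im atTop] fun _ => (1 : ℝ) := by
    simpa using ((ht.pow i).mul (hd.pow j)).const_mul_left b
  have h1 : (fun z => (cexp (Real.pi * I * z / 4) * psi z) ^ m) =O[comap im atTop]
      fun z => Real.exp (-(Real.pi * (m / 4)) * z.im) := by
    simpa [mul_pow] using (he m).mul (qExp_psi.isBigO_one.pow m)
  have h2 := h1.mul (((((hterm b₀ 32 0).add (hterm b₁ 24 1)).add (hterm b₂ 16 2)).add
    (hterm b₃ 8 3)).add (hterm b₄ 0 4))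
  simpa [heckePoly] using h2

theorem differentiableOn_heckePoly (m : ℕ) (b₀ b₁ b₂ b₃ b₄ : ℂ) :
    DifferentiableOn ℂ (fun z => heckePoly m b₀ b₁ b₂ b₃ b₄ (jacobiTheta z) (delta8 z))
      {z | 0 < z.im} := by
  have h : Differentiable ℂ fun p : ℂ × ℂ => heckePoly m b₀ b₁ b₂ b₃ b₄ p.1 p.2 := by
    unfold heckePoly
    fun_prop
  exact h.comp_differentiableOn (differentiableOn_jacobiTheta.prodMk differentiableOn_delta8)

/-- The theta series of an `n - 32` lattice is determined by its first five coefficients. -/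
theorem theta_eq_heckePoly (h : IsNSubLattice 4 Λ) {a₀ a₁ a₂ a₃ a₄ b₀ b₁ b₂ b₃ b₄ : ℂ}
    (hΛ : QExp (theta Λ) a₀ a₁ a₂ a₃ a₄)
    (hP : QExp (fun z => heckePoly m b₀ b₁ b₂ b₃ b₄ (jacobiTheta z) (delta8 z)) a₀ a₁ a₂ a₃ a₄)
    {z : ℂ} (hz : 0 < z.im) :
    theta Λ z = heckePoly m b₀ b₁ b₂ b₃ b₄ (jacobiTheta z) (delta8 z) := by
  have := h.1.discrete
  obtain ⟨w, hw⟩ := h.1.exists_isCharacteristic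
  set G : ℂ → ℂ := fun z =>
    theta Λ z - heckePoly m b₀ b₁ b₂ b₃ b₄ (jacobiTheta z) (delta8 z) with hG
  -- The required inequality reads 2π(m + 32) < 16·5π + 2πm. Agreement only modulo q⁴ would give
  -- equality, hence five coefficients.
  have hmain := eq_zero_of_theta_group (G := G) (n := m + 32) (a := 5 * Real.pi)
    (c := 2 * Real.pi * m) (differentiableOn_theta.sub (differentiableOn_heckePoly m b₀ b₁ b₂ b₃ b₄))
    (fun z hz => by
      simp only [hG]
      rw [theta_add_two h.1, jacobiTheta_add_two, delta8_add_two hz])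
    (fun z hz => by
      have : G (-1 / z) = autFactor z ^ (m + 32) * G z := by
        simp only [hG]
        rw [h.1.theta_neg_inv hz, jacobiTheta_neg_one_div hz, delta8_neg_one_div hz,
          heckePoly_smul, ← autFactor]
        ring
      rw [this, mul_pow, ← pow_mul, mul_comm (m + 32) 8, pow_mul, autFactor_pow_eight, ← pow_mul])
    (by
      refine (IsBigO.sub hΛ hP).congr_left fun z => ?_
      simp only [hG]
      ring)
    (by
      refine (((shadow_isBigO h hw).sub (heckePoly_isBigO b₀ b₁ b₂ b₃ b₄)).pow 8).congr' ?_
        (.of_forall fun z => ?_)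
      · filter_upwards [eventually_im_pos] with z hz
        have h1 : G (1 - 1 / z) = autFactor z ^ (m + 32) * ((∑' x : Λ, cexp (Real.pi * I *
            ((‖(2⁻¹ : ℝ) • w + (x : EuclideanSpace ℝ (Fin (m + 32)))‖ ^ 2 : ℝ) : ℂ) * z)) -
            heckePoly m b₀ b₁ b₂ b₃ b₄ (cexp (Real.pi * I * z / 4) * psi z)
              (-(jacobiTheta z ^ 4 * theta4 z ^ 4 / 16))) := by
          simp only [hG]
          rw [h.1.theta_one_sub_inv hz hw, jacobiTheta_one_sub_one_div hz,
            delta8_one_sub_one_div hz, neg_mul_comm (autFactor z ^ 8), heckePoly_smul, ← autFactor]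
          ring
        have h2 : z ^ (4 * (m + 32)) ≠ 0 := by
          refine pow_ne_zero _ ?_
          rintro rfl
          simp at hz
        rw [h1, mul_pow, ← pow_mul, mul_comm (m + 32) 8, pow_mul, autFactor_pow_eight, ← pow_mul,
          mul_div_cancel_left₀ _ h2]
      · beta_reduce
        rw [← Real.exp_nat_mul]
        ring_nf)
    (by push_cast; nlinarith [Real.pi_pos]) hz
  exact sub_eq_zero.1 hmain

/-- The coefficients of the theta series of an `n - 32` lattice without vectors of norm at most
three, with `A` vectors of norm four. -/
theorem qExp_heckePoly (m : ℕ) (N A : ℂ) (hN : N = m + 32) :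
    QExp (fun z => heckePoly m 1 (-2 * N) (2 * N ^ 2 - 46 * N)
      (-(4 / 3) * N ^ 3 + 92 * N ^ 2 - 4832 / 3 * N)
      (2 / 3 * N ^ 4 - 92 * N ^ 3 + 12838 / 3 * N ^ 2 - 67118 * N + A)
      (jacobiTheta z) (delta8 z)) 1 0 0 0 A := by
  have hm : (m : ℂ) = N - 32 := by rw [hN]; ring
  have d1 := qExp_delta8
  have d2 : QExp (fun z => delta8 z ^ 2) 0 0 1 (-16) 120 := by
    convert d1.mul d1 using 1
    · ext z
      ring
    all_goals norm_num
  have d3 : QExp (fun z => delta8 z ^ 3) 0 0 0 1 (-24) := by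
    convert d1.mul d2 using 1
    · ext z
      ring
    all_goals norm_num
  have d4 : QExp (fun z => delta8 z ^ 4) 0 0 0 0 1 := by
    convert d1.mul d3 using 1
    · ext z
      ring
    all_goals norm_num
  -- Since Δ₈^j starts with q^j, the coefficients solve a unitriangular system with right-hand side
  -- 1, 0, 0, 0, A.
  have hsum := (((((qExp_jacobiTheta_pow 32).const_mul 1).add
    (((qExp_jacobiTheta_pow 24).mul d1).const_mul (-2 * N))).add
    (((qExp_jacobiTheta_pow 16).mul d2).const_mul (2 * N ^ 2 - 46 * N))).add
    (((qExp_jacobiTheta_pow 8).mul d3).const_mul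
      (-(4 / 3) * N ^ 3 + 92 * N ^ 2 - 4832 / 3 * N))).add
    (d4.const_mul (2 / 3 * N ^ 4 - 92 * N ^ 3 + 12838 / 3 * N ^ 2 - 67118 * N + A))
  have hprod := (qExp_jacobiTheta_pow m).mul hsum
  rw [hm] at hprod
  convert hprod using 1
  · ext z
    rw [heckePoly]
  all_goals (push_cast; ring)

end Hecke

/-! ### The theta series of ℤⁿ -/

section Cubic

open Complex Filter Asymptotics

/-- The theta series of `ℤⁿ` as a product. -/
theorem hasSum_pi_exp {z : ℂ} (hz : 0 < z.im) (n : ℕ) :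
    (Summable fun c : Fin n → ℤ => ‖cexp (Real.pi * I * (∑ i, (c i : ℂ) ^ 2) * z)‖) ∧
      ∑' c : Fin n → ℤ, cexp (Real.pi * I * (∑ i, (c i : ℂ) ^ 2) * z) = jacobiTheta z ^ n := by
  have h1 : Summable fun k : ℤ => ‖cexp (Real.pi * I * (k : ℂ) ^ 2 * z)‖ := by
    have := (hasSum_jacobiTheta₂_term 0 hz).summable.norm
    simpa [jacobiTheta₂_term] using this
  induction n with
  | zero =>
    refine ⟨.of_finite, ?_⟩
    simp
  | succ n ih =>
    let e := Fin.consEquiv fun _ : Fin (n + 1) => ℤ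
    have he : ∀ p : ℤ × (Fin n → ℤ), cexp (Real.pi * I * (∑ i, ((e p i : ℤ) : ℂ) ^ 2) * z) =
        cexp (Real.pi * I * (p.1 : ℂ) ^ 2 * z) *
          cexp (Real.pi * I * (∑ i, (p.2 i : ℂ) ^ 2) * z) := by
      intro p
      rw [← Complex.exp_add, Fin.sum_univ_succ]
      simp only [e, Fin.consEquiv_apply, Fin.cons_zero, Fin.cons_succ]
      ring_nf
    constructor
    · rw [← e.summable_iff]
      refine (h1.mul_norm ih.1).congr fun p => ?_
      simp only [Function.comp, he]
    · rw [← e.tsum_eq, pow_succ', ← ih.2, jacobiTheta, tsum_mul_tsum_of_summable_norm h1 ih.1]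
      exact tsum_congr he

theorem theta_cubicLattice (n : ℕ) {z : ℂ} (hz : 0 < z.im) :
    theta (cubicLattice n) z = jacobiTheta z ^ n := by
  rw [← (hasSum_pi_exp hz n).2]
  let B := (EuclideanSpace.basisFun (Fin n) ℝ).toBasis
  let e := (B.restrictScalars ℤ).equivFun.toEquiv
  have he : ∀ x : cubicLattice n, ‖(x : EuclideanSpace ℝ (Fin n))‖ ^ 2 = ∑ i, ((e x i : ℤ) : ℝ) ^ 2 := by
    intro x
    rw [EuclideanSpace.real_norm_sq_eq]
    refine Finset.sum_congr rfl fun i _ => ?_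
    congr 1
    have := B.restrictScalars_repr_apply ℤ x i
    simp only [B, OrthonormalBasis.coe_toBasis_repr_apply, EuclideanSpace.basisFun_repr] at this
    rw [← this]
    rfl
  rw [← e.tsum_eq, theta]
  refine tsum_congr fun x => ?_
  rw [he]
  push_cast
  rfl

end Cubic

/-! ### Numerical estimates at z = i and the contradiction -/

section Final

open Complex Filter

theorem exp_neg_pi_le : Real.exp (-Real.pi) ≤ 1 / 20 := by
  have h1 : (20 : ℝ) ≤ Real.exp 3 := by
    have h := Real.exp_one_gt_d9
    rw [show (3 : ℝ) = (3 : ℕ) * 1 by norm_num, Real.exp_nat_mul]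
    calc (20 : ℝ) ≤ 2.7182818283 ^ 3 := by norm_num
      _ ≤ Real.exp 1 ^ 3 := by gcongr
  calc Real.exp (-Real.pi) ≤ Real.exp (-3) := Real.exp_le_exp.2 (by linarith [Real.pi_gt_three])
    _ = (Real.exp 3)⁻¹ := Real.exp_neg 3
    _ ≤ 20⁻¹ := by gcongr
    _ = 1 / 20 := by norm_num

theorem norm_jacobiTheta_sub_one_le_of_im_eq_one {z : ℂ} (hz : z.im = 1) :
    ‖jacobiTheta z - 1‖ ≤ 11 / 100 := by
  have h := norm_jacobiTheta_sub_one_le (τ := z) (by rw [hz]; norm_num)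
  rw [hz, mul_one] at h
  refine h.trans ?_
  have h1 := exp_neg_pi_le
  -- With e^(-π) ≤ 1/20 the bound 2e^(-π)/(1 - e^(-π)) is at most 2/19 < 11/100.
  rw [div_mul_eq_mul_div, div_le_iff₀ (by linarith)]
  linarith

theorem exists_real_jacobiTheta_I : ∃ t : ℝ, jacobiTheta I = t ∧ |t - 1| ≤ 11 / 100 := by
  obtain ⟨t, ht⟩ : ∃ t : ℝ, jacobiTheta I = t := by
    rw [← Complex.conj_eq_iff_real, jacobiTheta_eq_jacobiTheta₂, jacobiTheta₂_conj]
    simp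
  refine ⟨t, ht, ?_⟩
  have := norm_jacobiTheta_sub_one_le_of_im_eq_one (z := I) (by simp)
  rwa [ht, ← Complex.ofReal_one, ← Complex.ofReal_sub, Complex.norm_real] at this

theorem exists_real_theta4_I : ∃ t : ℝ, theta4 I = t ∧ |t - 1| ≤ 11 / 100 := by
  obtain ⟨t, ht⟩ : ∃ t : ℝ, theta4 I = t := by
    rw [← Complex.conj_eq_iff_real, theta4_eq_jacobiTheta₂, jacobiTheta₂_conj]
    simp [Complex.conj_ofNat]
  refine ⟨t, ht, ?_⟩
  have := norm_jacobiTheta_sub_one_le_of_im_eq_one (z := I + 1) (by simp)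
  rw [← theta4, ht] at this
  rwa [← Complex.ofReal_one, ← Complex.ofReal_sub, Complex.norm_real] at this

/-- The point i is fixed by inversion, so θ₂(i) = θ₄(i). -/
theorem delta8_I : delta8 I = theta4 I ^ 8 / 16 := by
  have h := cexp_mul_psi_neg_one_div (z := I) (by simp)
  have h1 : -1 / I = I := by rw [div_eq_iff I_ne_zero, I_mul_I]
  have h2 : autFactor I = 1 := by simp [autFactor]
  rw [h1, h2, one_mul] at h
  rw [delta8_eq, h]
  ring

/-- The inequality that makes the secrecy function of an `n - 32` lattice too small at `1`. -/
theorem heckePoly_gt {m : ℕ} {N A t d : ℝ} (hN : N = m + 32) (hN' : 14941 ≤ N) (hA : 0 ≤ A)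
    (ht : 0 < t) (hd : t ^ 8 / 100 ≤ d) :
    t ^ (m + 32) < t ^ m * (t ^ 32 + -2 * N * (t ^ 24 * d) +
      (2 * N ^ 2 - 46 * N) * (t ^ 16 * d ^ 2) +
      (-(4 / 3) * N ^ 3 + 92 * N ^ 2 - 4832 / 3 * N) * (t ^ 8 * d ^ 3) +
      (2 / 3 * N ^ 4 - 92 * N ^ 3 + 12838 / 3 * N ^ 2 - 67118 * N + A) * d ^ 4) := by
  rw [pow_add]
  refine mul_lt_mul_of_pos_left ?_ (by positivity)
  -- Dividing by t³² leaves a quartic in x alone. Its odd terms are absorbed by the next even ones,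
  -- in the pairs `h1` and `h2`; these estimates already work for N ≥ 348.
  obtain ⟨x, hx⟩ : ∃ x, x = d / t ^ 8 := ⟨_, rfl⟩
  have hdx : d = x * t ^ 8 := by rw [hx]; field_simp
  have hx1 : 1 / 100 ≤ x := by
    rw [hx, le_div_iff₀ (by positivity)]
    linarith
  have hx0 : 0 < x := by linarith
  rw [hdx]
  have h1 : 0 < -2 * N + (2 * N ^ 2 - 46 * N) * x := by
    have e : 2 < (2 * N - 46) * x := by nlinarith
    nlinarith
  have h2 : 0 < (-(4 / 3) * N ^ 3 + 92 * N ^ 2 - 4832 / 3 * N) +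
      (2 / 3 * N ^ 4 - 92 * N ^ 3 + 12838 / 3 * N ^ 2 - 67118 * N + A) * x := by
    -- The constant 140 is chosen because 140/100 exceeds 4/3, the size of the negative cubic
    -- coefficient.
    have h3 : 140 * N ^ 3 ≤ (2 / 3 * N ^ 4 - 92 * N ^ 3 + 12838 / 3 * N ^ 2 - 67118 * N + A) := by
      have e1 : 0 ≤ N ^ 3 * (2 / 3 * N - 232) := by
        have : 0 ≤ 2 / 3 * N - 232 := by linarith
        positivity
      have e2 : 0 ≤ N * (12838 / 3 * N - 67118) := by
        have : 0 ≤ 12838 / 3 * N - 67118 := by linarith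
        positivity
      nlinarith
    have h4 : 140 * N ^ 3 * (1 / 100) ≤
        (2 / 3 * N ^ 4 - 92 * N ^ 3 + 12838 / 3 * N ^ 2 - 67118 * N + A) * x :=
      mul_le_mul h3 hx1 (by norm_num) (le_trans (by positivity) h3)
    have h5 : 0 < N * (92 * N - 4832 / 3) := by
      have : 0 < 92 * N - 4832 / 3 := by linarith
      positivity
    have h6 : 0 < N ^ 3 := by positivity
    nlinarith
  have h3 : 0 < t ^ 32 * x * ((-2 * N + (2 * N ^ 2 - 46 * N) * x) +
      ((-(4 / 3) * N ^ 3 + 92 * N ^ 2 - 4832 / 3 * N) +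
      (2 / 3 * N ^ 4 - 92 * N ^ 3 + 12838 / 3 * N ^ 2 - 67118 * N + A) * x) * x ^ 2) := by
    positivity
  nlinarith

/-- High on the imaginary axis only the zero vector contributes to either theta series. -/
theorem IsUnimodular.tendsto_secrecyFunction {n : ℕ}
    {Λ : Submodule ℤ (EuclideanSpace ℝ (Fin n))} {a₁ a₂ a₃ a₄ : ℂ}
    (hΛ : QExp (theta Λ) 1 a₁ a₂ a₃ a₄) :
    Tendsto (secrecyFunction Λ) atTop (nhds 1) := by
  have h1 : Tendsto (fun y : ℝ => (y : ℂ) * I) atTop (comap im atTop) := by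
    rw [tendsto_comap_iff]
    refine tendsto_id.congr fun y => ?_
    simp
  have h2 : Tendsto (theta (cubicLattice n)) (comap im atTop) (nhds 1) := by
    refine (qExp_jacobiTheta_pow n).tendsto.congr' ?_
    filter_upwards [eventually_im_pos] with z hz
    exact (theta_cubicLattice n hz).symm
  have h3 := (h2.comp h1).div (hΛ.tendsto.comp h1) one_ne_zero
  rw [div_one] at h3
  exact (Complex.continuous_re.tendsto 1).comp h3

/-- Under the Belfiore–Solé conjecture, an `n - 32` lattice in dimension `n ≥ 14941` has a
nonzero vector of norm at most `3`. -/
theorem not_isNSubLattice_four (hBS : BelfioreSoleConjecture) (n : ℕ) (hn : 14941 ≤ n) :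
    ¬ ∃ Λ : Submodule ℤ (EuclideanSpace ℝ (Fin n)),
      IsNSubLattice 4 Λ ∧ ∀ x ∈ Λ, x ≠ 0 → 3 < (inner ℝ x x : ℝ) := by
  rintro ⟨Λ, h, hmin⟩
  obtain ⟨m, rfl⟩ : ∃ m, n = m + 32 := ⟨n - 32, by omega⟩
  obtain ⟨A, hA, hΛ⟩ := h.1.qExp_theta hmin
  obtain ⟨t, ht, htb⟩ := exists_real_jacobiTheta_I
  obtain ⟨s, hs, hsb⟩ := exists_real_theta4_I
  rw [abs_le] at htb hsb
  have hI : 0 < I.im := by simp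
  have hval := theta_eq_heckePoly h hΛ
    (qExp_heckePoly m ((m + 32 : ℝ) : ℂ) A (by push_cast; rfl)) hI
  -- The bounds t ≤ 1.11 and s ≥ 0.89 give 0.0231 against 0.0246; this fixes the constant 1/100.
  have hd : (t : ℝ) ^ 8 / 100 ≤ s ^ 8 / 16 := by
    have h1 : t ^ 8 ≤ (111 / 100) ^ 8 := by
      have : 0 ≤ t := by linarith
      gcongr
      linarith
    have h2 : (89 / 100 : ℝ) ^ 8 ≤ s ^ 8 := by
      gcongr
      linarith
    norm_num at h1 h2
    linarith
  have hgt := heckePoly_gt (m := m) (N := m + 32) (A := A) (t := t) (d := s ^ 8 / 16) rfl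
    (by exact_mod_cast hn) hA (by linarith) hd
  rw [ht, delta8_I, hs, heckePoly] at hval
  set P : ℝ := t ^ m * (t ^ 32 + -2 * ((m : ℝ) + 32) * (t ^ 24 * (s ^ 8 / 16)) +
      (2 * ((m : ℝ) + 32) ^ 2 - 46 * ((m : ℝ) + 32)) * (t ^ 16 * (s ^ 8 / 16) ^ 2) +
      (-(4 / 3) * ((m : ℝ) + 32) ^ 3 + 92 * ((m : ℝ) + 32) ^ 2 - 4832 / 3 * ((m : ℝ) + 32)) *
        (t ^ 8 * (s ^ 8 / 16) ^ 3) +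
      (2 / 3 * ((m : ℝ) + 32) ^ 4 - 92 * ((m : ℝ) + 32) ^ 3 + 12838 / 3 * ((m : ℝ) + 32) ^ 2 -
        67118 * ((m : ℝ) + 32) + A) * (s ^ 8 / 16) ^ 4) with hP
  have hval' : theta Λ I = (P : ℂ) := by
    rw [hval, hP]
    push_cast
    ring
  have hsec : secrecyFunction Λ 1 = t ^ (m + 32) / P := by
    rw [secrecyFunction, Complex.ofReal_one, one_mul, theta_cubicLattice _ hI, hval', ht]
    norm_cast
  have htpos : 0 < t ^ (m + 32) := by
    have : 0 < t := by linarith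
    positivity
  have hlt : secrecyFunction Λ 1 < 1 := by
    rw [hsec, div_lt_one (htpos.trans hgt)]
    exact hgt
  have hmax := hBS (m + 32) Λ h.1
  have hlim := IsUnimodular.tendsto_secrecyFunction hΛ
  have hle : (1 : ℝ) ≤ secrecyFunction Λ 1 := by
    refine le_of_tendsto hlim ?_
    filter_upwards [eventually_gt_atTop 0] with y hy
    exact hmax hy
  linarith

end Final

end SecrecyGain

theorem mainTheorem8 (hBS : SecrecyGain.BelfioreSoleConjecture) (n : ℕ) (hn : 14941 ≤ n) :
    ¬ ∃ Λ : Submodule ℤ (EuclideanSpace ℝ (Fin n)),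
      SecrecyGain.IsNSubLattice 4 Λ ∧ ∀ x ∈ Λ, x ≠ 0 → 3 < (inner ℝ x x : ℝ) :=
  SecrecyGain.not_isNSubLattice_four hBS n hn
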